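/- Algebras are considered in the language $\langle \oplus, \neg, 0, \exists, \forall\rangle$ of type $(2,1,0,1,1)$, with the abbreviations $1 := \neg 0$, $x \to y := \neg x \oplus y$, $x * y := \neg(\neg x \oplus \neg y)$, $x \vee y := (x \to y) \to y$ and $x \wedge y := \neg(\neg x \vee \neg y)$. A *monadic MV-algebra* is an algebra $\langle \mathbf{A}, \exists, \forall\rangle$ such that $\mathbf{A} = \langle A, \oplus, \neg, 0\rangle$ is an MV-algebra and the following identities hold: $$\forall x \to x \approx 1,\qquad \forall(x \to \forall y) \approx \exists x \to \forall y,\qquad \forall(\forall x \to y) \approx \forall x \to \forall y,$$ $$\forall(\exists x \vee y) \approx \exists x \vee \forall y,\qquad \exists(x * x) \approx \exists x * \exists x.$$ For a natural number $k$, let $\mathbb{MMV}_k$ be the variety of all monadic MV-algebras (of width $\le k$) that satisfy the identity $$\bigwedge_{1 \le i < j \le k+1} \forall(x_i \vee x_j) \to \bigvee_{i=1}^{k+1} \forall x_i \approx 1, \tag{$W_k$}$$ where an empty meet is $1$. Let $[0,1]_{\text{Ł}}$ be the standard MV-algebra on the real unit interval, with $x \oplus y = \min(1, x+y)$ and $\neg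 x = 1 - x$, and let $\langle [0,1]_{\text{Ł}}^k, \exists_\vee, \forall_\wedge\rangle$ be the power $[0,1]_{\text{Ł}}^k$ with pointwise MV-operations, where, for $f \in [0,1]^k$, $\exists_\vee f$ and $\forall_\wedge f$ are the constant tuples with value $\sup_i f(i)$ and $\inf_i f(i)$, respectively (for $k = 0$ this is the one-element algebra). A *quasi-identity* is an implication $s_1 \approx t_1 \mathbin{\&} \cdots \mathbin{\&} s_n \approx t_n \Rightarrow s \approx t$ (with $n \ge 0$) between terms of the language, understood as universally quantified; a *quasivariety* is the class of all algebras satisfying some set of quasi-identities; the quasivariety *generated by* an algebra is the least quasivariety to which it belongs. **Corollary.** For every natural number $k$, $\mathbb{MMV}_k$ is the quasivariety generated by the single algebra $\langle [0,1]_{\text{Ł}}^k, \exists_\vee, \forall_\wedge\rangle$. -/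

import Mathlib

universe u v

namespace MonadicMV

open FirstOrder

/-- Operation symbols of monadic MV-algebras: truncated sum, negation, zero and the two
quantifiers. -/
inductive Func : ℕ → Type
  | add : Func 2
  | neg : Func 1
  | zero : Func 0
  | ex : Func 1
  | all : Func 1

/-- The (purely algebraic) language of monadic MV-algebras. -/
def lang : FirstOrder.Language.{0, 0} where
  Functions := Func
  Relations := fun _ => Empty

section Operations

variable {A : Type*} [lang.Structure A]

/-- Truncated sum. -/
def oplus (x y : A) : A := FirstOrder.Language.Structure.funMap (L := lang) Func.add ![x, y]

/-- Negation. -/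
def neg (x : A) : A := FirstOrder.Language.Structure.funMap (L := lang) Func.neg ![x]

/-- The constant `0`. -/
def zero : A := FirstOrder.Language.Structure.funMap (L := lang) Func.zero ![]

/-- The existential quantifier. -/
def ex (x : A) : A := FirstOrder.Language.Structure.funMap (L := lang) Func.ex ![x]

/-- The universal quantifier. -/
def all (x : A) : A := FirstOrder.Language.Structure.funMap (L := lang) Func.all ![x]

/-- `1 = ¬0`. -/
def one : A := neg zero

/-- `x → y = ¬x ⊕ y`. -/
def imp (x y : A) : A := oplus (neg x) y

/-- `x * y = ¬(¬x ⊕ ¬y)`. -/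
def conj (x y : A) : A := neg (oplus (neg x) (neg y))

/-- `x ∨ y = (x → y) → y`. -/
def sup (x y : A) : A := imp (imp x y) y

/-- `x ∧ y = ¬(¬x ∨ ¬y)`. -/
def inf (x y : A) : A := neg (sup (neg x) (neg y))

/-- Finite meet `x₁ ∧ (x₂ ∧ (⋯ ∧ 1))`. -/
def bigInf (l : List A) : A := l.foldr inf one

/-- Finite join `x₁ ∨ (x₂ ∨ (⋯ ∨ 0))`. -/
def bigSup (l : List A) : A := l.foldr sup zero

end Operations

/-- The `⟨⊕, ¬, 0⟩`-reduct of `A` is an MV-algebra. -/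
structure IsMV (A : Type*) [lang.Structure A] : Prop where
  add_assoc : ∀ x y z : A, oplus x (oplus y z) = oplus (oplus x y) z
  add_comm : ∀ x y : A, oplus x y = oplus y x
  add_zero : ∀ x : A, oplus x zero = x
  neg_neg : ∀ x : A, neg (neg x) = x
  add_one : ∀ x : A, oplus x (neg zero) = neg zero
  lukasiewicz : ∀ x y : A, oplus (neg (oplus (neg x) y)) y = oplus (neg (oplus (neg y) x)) x

/-- `A` is a monadic MV-algebra. -/
structure IsMonadicMV (A : Type*) [lang.Structure A] : Prop extends IsMV A where
  all_imp_self : ∀ x : A, imp (all x) x = one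
  all_imp_all : ∀ x y : A, all (imp x (all y)) = imp (ex x) (all y)
  all_all_imp : ∀ x y : A, all (imp (all x) y) = imp (all x) (all y)
  all_ex_sup : ∀ x y : A, all (sup (ex x) y) = sup (ex x) (all y)
  ex_conj_self : ∀ x : A, ex (conj x x) = conj (ex x) (ex x)

/-- The list of all pairs `(i, j)` of indices with `i < j`. -/
def ltPairs (n : ℕ) : List (Fin n × Fin n) :=
  (List.finRange n ×ˢ List.finRange n).filter fun p => p.1 < p.2

/-- The identity `W_k`: `⋀_{i < j} ∀(x_i ∨ x_j) → ⋁_i ∀ x_i ≈ 1`, where the indices `i`, `j`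
range over a set of `k + 1` elements. -/
def SatisfiesW (k : ℕ) (A : Type*) [lang.Structure A] : Prop :=
  ∀ x : Fin (k + 1) → A,
    imp (bigInf ((ltPairs (k + 1)).map fun p => all (sup (x p.1) (x p.2))))
      (bigSup ((List.finRange (k + 1)).map fun i => all (x i))) = one

/-- Algebras (with carrier in `Type u`) in the language of monadic MV-algebras. -/
abbrev Alg := CategoryTheory.Bundled.{u} lang.Structure

instance (A : Alg.{u}) : lang.Structure A := A.str

/-- The variety `MMV_k` of monadic MV-algebras of width at most `k`. -/
def MMV (k : ℕ) : Set Alg.{u} := {A | IsMonadicMV A ∧ SatisfiesW k A}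

/-- A quasi-identity `s₁ ≈ t₁ & ⋯ & sₙ ≈ tₙ ⇒ s ≈ t`, with variables indexed by `ℕ`. -/
structure QuasiIdentity where
  /-- The finitely many premises `sᵢ ≈ tᵢ`. -/
  premises : List (lang.Term ℕ × lang.Term ℕ)
  /-- The conclusion `s ≈ t`. -/
  conclusion : lang.Term ℕ × lang.Term ℕ

/-- The quasi-identity `q` holds in `A` (under all valuations). -/
def QuasiIdentity.Holds (q : QuasiIdentity) (A : Type*) [lang.Structure A] : Prop :=
  ∀ v : ℕ → A, (∀ e ∈ q.premises, e.1.realize v = e.2.realize v) →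
    q.conclusion.1.realize v = q.conclusion.2.realize v

/-- The quasivariety axiomatized by a set of quasi-identities. -/
def quasivariety (S : Set QuasiIdentity) : Set Alg.{u} := {A | ∀ q ∈ S, q.Holds A}

/-- The quasivariety generated by `B`: the intersection of all the quasivarieties to which `B`
belongs. -/
def generatedQuasivariety (B : Alg.{v}) : Set Alg.{u} :=
  ⋂ (S : Set QuasiIdentity) (_ : B ∈ quasivariety.{v} S), quasivariety.{u} S

/-- Truncated addition `min 1 (x + y)` on the real unit interval. -/
noncomputable def truncAdd (x y : unitInterval) : unitInterval :=
  ⟨min 1 ((x : ℝ) + y), le_min zero_le_one (add_nonneg x.2.1 y.2.1), min_le_left _ _⟩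

/-- The carrier of the functional algebra: all maps from `X` to the real unit interval. -/
abbrev Cube (X : Type*) : Type _ := X → unitInterval

/-- The Łukasiewicz operations act pointwise, and the quantifiers send `f` to the constant maps
with value the supremum, respectively the infimum, of the values of `f`. -/
noncomputable instance (X : Type*) : lang.Structure (Cube X) where
  funMap := fun {_} f => match f with
    | Func.add => fun a => fun i : X => truncAdd (a 0 i) (a 1 i)
    | Func.neg => fun a => fun i : X => unitInterval.symm (a 0 i)
    | Func.zero => fun _ => fun _ : X => (0 : unitInterval)
    | Func.ex => fun a => fun _ : X => ⨆ j : X, (a 0 j : unitInterval)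
    | Func.all => fun a => fun _ : X => ⨅ j : X, (a 0 j : unitInterval)
  RelMap := fun {_} r => nomatch r

/-- The algebra `⟨[0,1]_Ł^k, ∃_∨, ∀_∧⟩`. -/
noncomputable def stdAlg (k : ℕ) : Alg.{0} := ⟨Cube (Fin k), inferInstance⟩

end MonadicMV

/-!
A quasi-identity that fails in an algebra of `MMV k` fails on a finite part of it, so it is enough
to map every finite part to the cube `[0, 1] ^ k`, preserving the operations and separating two
given elements `a ≰ b`. Choose a prime filter `p` of the algebra of the fixed elements of `∀` with
`∀ (a → b) ∉ p`. The width condition leaves at most `k` filters of the whole algebra that are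
maximal among those with trace `p`. They are prime, and each `x → ∀ x` lies in one of them, so that
`∀ x` is the minimum of the images of `x` in the corresponding quotients. These quotients are chains
that contain a common chain, the quotient by `p`. Passing to Chang's ordered groups, a theorem of
the alternative (a finite set of vectors whose additive semigroup does not contain `0` is positive
under some homomorphism to `ℝ`), applied in the amalgam of these groups over the common subgroup,
gives compatible homomorphisms to `ℝ` that preserve the order of finitely many given elements. Their
normalizations are the coordinates of the required map. Conversely, `[0, 1] ^ k` satisfies the
defining identities: among `k + 1` functions on `k` points, two attain their minima at the same
point.
-/

section LinearFunctionals

theorem nsmul_mem_of_pos {W : Type*} [AddMonoid W] {S : AddSubsemigroup W} {w : W}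
    (hw : w ∈ S) {n : ℕ} (hn : 0 < n) : n • w ∈ S := by
  induction n, hn using Nat.le_induction with
  | base => simpa using hw
  | succ n _ ih => exact succ_nsmul w n ▸ add_mem ih hw

theorem pos_of_zsmul_mem {W : Type*} [AddGroup W] {S : AddSubsemigroup W} (h0 : 0 ∉ S) {w : W}
    (hw : w ∈ S) {z : ℤ} (hz : z • w ∈ S) : 0 < z := by
  by_contra! hz0
  obtain ⟨n, rfl⟩ := Int.exists_eq_neg_ofNat hz0
  obtain rfl | hn := n.eq_zero_or_pos
  · exact h0 (by simpa using hz)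
  · refine h0 ?_
    have := add_mem hz (nsmul_mem_of_pos hw hn)
    rwa [neg_zsmul, natCast_zsmul, neg_add_cancel] at this

theorem exists_addMonoidHom_pos {W : Type*} [AddCommGroup W] {w : W} (hw : ¬ IsOfFinAddOrder w) :
    ∃ f : W →+ ℝ, 0 < f w := by
  have hinj : Function.Injective (zmultiplesHom W w) := injective_zsmul_iff_not_isOfFinAddOrder.2 hw
  obtain ⟨f, hf⟩ := (Module.Baer.of_divisible ℝ).extension_property_addMonoidHom
    (zmultiplesHom W w) hinj (zmultiplesHom ℝ 1)
  refine ⟨f, ?_⟩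
  have h1 := DFunLike.congr_fun hf 1
  simp only [AddMonoidHom.comp_apply, zmultiplesHom_apply, one_smul] at h1
  exact h1 ▸ one_pos

theorem not_isOfFinAddOrder_of_mem {W : Type*} [AddMonoid W] {S : AddSubsemigroup W}
    (h0 : 0 ∉ S) {w : W} (hw : w ∈ S) : ¬ IsOfFinAddOrder w := by
  rw [isOfFinAddOrder_iff_nsmul_eq_zero]
  rintro ⟨n, hn, h⟩
  exact h0 (h ▸ nsmul_mem_of_pos hw hn)

theorem pos_of_mem_addSubsemigroup_closure {W : Type*} [AddZeroClass W] {t : Set W} {f : W →+ ℝ}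
    (hf : ∀ w ∈ t, 0 < f w) {w : W} (hw : w ∈ AddSubsemigroup.closure t) : 0 < f w := by
  induction hw using AddSubsemigroup.closure_induction with
  | mem w hw => exact hf w hw
  | add x y _ _ hx hy => exact map_add f x y ▸ add_pos hx hy

theorem exists_nat_forall_pos_mul_add {ι : Type*} (s : Finset ι) {u : ι → ℝ}
    (hu : ∀ i ∈ s, 0 < u i) (v : ι → ℝ) : ∃ N : ℕ, ∀ i ∈ s, 0 < N * u i + v i := by
  have hlim : ∀ i ∈ s, ∀ᶠ N : ℕ in Filter.atTop, 0 < N * u i + v i := fun i hi =>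
    (Filter.tendsto_atTop_add_const_right _ _
      (tendsto_natCast_atTop_atTop.atTop_mul_const (hu i hi))).eventually_gt_atTop 0
  exact ((Filter.eventually_all_finset s).2 hlim).exists

theorem exists_addMonoidHom_forall_pos {ι W : Type*} [AddCommGroup W] (s : Finset ι)
    (p : ι → W) (h0 : 0 ∉ AddSubsemigroup.closure (p '' s)) :
    ∃ f : W →+ ℝ, ∀ i ∈ s, 0 < f (p i) := by
  classical
  induction s using Finset.induction_on generalizing W with
  | empty => exact ⟨0, by simp⟩
  | insert a s _ ih =>
    rw [Finset.coe_insert, Set.image_insert_eq] at h0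
    have ha := AddSubsemigroup.subset_closure (Set.mem_insert (p a) (p '' s))
    have hmono := AddSubsemigroup.closure_mono (Set.subset_insert (p a) (p '' s))
    -- Solve the problem modulo `p a` if possible; otherwise a positive multiple of `p a` lies in
    -- the closure of the other vectors, so that a solution for these is positive at `p a` too.
    let π := QuotientAddGroup.mk' (AddSubgroup.zmultiples (p a))
    by_cases hπ : 0 ∈ AddSubsemigroup.closure ((π ∘ p) '' s)
    · obtain ⟨f, hf⟩ := ih p fun h => h0 (hmono h)
      refine ⟨f, (Finset.forall_mem_insert ..).2 ⟨?_, hf⟩⟩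
      obtain ⟨x, hx, hπx⟩ : 0 ∈ (AddSubsemigroup.closure (p '' s)).map π.toAddHom := by
        rwa [AddHom.map_mclosure, ← Set.image_comp]
      obtain ⟨z, rfl⟩ := AddSubgroup.mem_zmultiples_iff.1 ((QuotientAddGroup.eq_zero_iff x).1 hπx)
      have hz : 0 < z := pos_of_zsmul_mem h0 ha (hmono hx)
      have hfx : 0 < f (z • p a) := pos_of_mem_addSubsemigroup_closure (by simpa using hf) hx
      rw [map_zsmul, zsmul_eq_mul] at hfx
      exact pos_of_mul_pos_right hfx (by exact_mod_cast hz.le)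
    · obtain ⟨f, hf⟩ := ih (π ∘ p) hπ
      obtain ⟨g, hg⟩ := exists_addMonoidHom_pos (not_isOfFinAddOrder_of_mem h0 ha)
      obtain ⟨N, hN⟩ := exists_nat_forall_pos_mul_add s hf fun i => g (p i)
      have hπa : π (p a) = 0 :=
        (QuotientAddGroup.eq_zero_iff (p a)).2 (AddSubgroup.mem_zmultiples _)
      refine ⟨N • f.comp π + g, (Finset.forall_mem_insert ..).2 ⟨?_, fun i hi => ?_⟩⟩
      · simpa [hπa] using hg
      · simpa using hN i hi

end LinearFunctionals

section OrderedGroups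

theorem pos_of_mem_addSubsemigroup_closure_pos {G : Type*} [AddCommGroup G] [PartialOrder G]
    [IsOrderedAddMonoid G] {g : G} (hg : g ∈ AddSubsemigroup.closure {x : G | 0 < x}) : 0 < g := by
  induction hg using AddSubsemigroup.closure_induction with
  | mem _ hx => exact hx
  | add x y _ _ hx hy => exact add_pos hx hy

theorem exists_addMonoidHom_strictMonoOn {G : Type*} [AddCommGroup G] [PartialOrder G]
    [IsOrderedAddMonoid G] {N : AddSubgroup G} (hN : ∀ x ∈ N, ¬ 0 < x) {S : Set G}
    (hS : S.Finite) : ∃ φ : G →+ ℝ, N ≤ φ.ker ∧ StrictMonoOn φ S := by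
  classical
  let D := {p ∈ hS.toFinset ×ˢ hS.toFinset | p.1 < p.2}
  let π := QuotientAddGroup.mk' N
  have h0 : 0 ∉ AddSubsemigroup.closure ((fun p : G × G => π (p.2 - p.1)) '' D) := by
    rw [show (fun p : G × G => π (p.2 - p.1)) = π.toAddHom ∘ fun p => p.2 - p.1 from rfl,
      Set.image_comp, ← AddHom.map_mclosure]
    rintro ⟨x, hx, hπx⟩
    refine hN x ((QuotientAddGroup.eq_zero_iff x).1 hπx)
      (pos_of_mem_addSubsemigroup_closure_pos (AddSubsemigroup.closure_mono ?_ hx))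
    rintro _ ⟨p, hp, rfl⟩
    exact sub_pos.2 (Finset.mem_filter.1 hp).2
  obtain ⟨f, hf⟩ := exists_addMonoidHom_forall_pos D _ h0
  refine ⟨f.comp π, fun x hx => ?_, fun x hx y hy hxy => ?_⟩
  · have hπx : π x = 0 := (QuotientAddGroup.eq_zero_iff x).2 hx
    simp [hπx]
  · simpa using hf (x, y) (by simp [D, hx, hy, hxy])

theorem exists_compatible_addMonoidHom_strictMonoOn {ι H : Type*} {G : ι → Type*} [Finite ι]
    [AddCommGroup H] [PartialOrder H] [IsOrderedAddMonoid H] [∀ i, AddCommGroup (G i)]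
    [∀ i, PartialOrder (G i)] [∀ i, IsOrderedAddMonoid (G i)] (f : ∀ i, H →+ G i)
    (hf : ∀ i h, 0 ≤ f i h → 0 ≤ h) {S : ∀ i, Set (G i)} (hS : ∀ i, (S i).Finite) :
    ∃ φ : ∀ i, G i →+ ℝ, (∀ i j, (φ i).comp (f i) = (φ j).comp (f j)) ∧
      ∀ i, StrictMonoOn (φ i) (S i) := by
  classical
  have := Fintype.ofFinite ι
  -- Killing `N` identifies the copies of `H` in the product of the groups `G i`.
  let N : AddSubgroup (∀ i, G i) := ((∑ i, Pi.evalAddMonoidHom _ i : (ι → H) →+ H).ker).map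
    (AddMonoidHom.pi fun i => (f i).comp (Pi.evalAddMonoidHom _ i))
  have hN : ∀ x ∈ N, ¬ 0 < x := by
    rintro _ ⟨h, hh, rfl⟩ hpos
    have hnonneg : ∀ i, 0 ≤ h i := fun i => hf i (h i) (hpos.le i)
    have hsum : ∑ i, h i = 0 := by simpa using hh
    have hzero := (Finset.sum_eq_zero_iff_of_nonneg fun i _ => hnonneg i).1 hsum
    exact hpos.ne' (funext fun i =>
      (congrArg (f i) (hzero i (Finset.mem_univ i))).trans (map_zero (f i)))
  obtain ⟨φ, hφN, hφ⟩ := exists_addMonoidHom_strictMonoOn hN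
    (Set.finite_iUnion fun i => (hS i).image (Pi.single i))
  refine ⟨fun i => φ.comp (AddMonoidHom.single G i), fun i j => ?_, fun i x hx y hy hxy => ?_⟩
  · ext h
    have hmem : Pi.single i (f i h) - Pi.single j (f j h) ∈ N := by
      refine ⟨Pi.single i h - Pi.single j h, by simp, ?_⟩
      refine funext fun l => (map_sub (f l) _ _).trans ?_
      exact congrArg₂ (· - ·) (Pi.apply_single (fun l => f l) (fun l => map_zero (f l)) i h l)
        (Pi.apply_single (fun l => f l) (fun l => map_zero (f l)) j h l)
    simpa [sub_eq_zero] using hφN hmem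
  · exact hφ (Set.mem_iUnion_of_mem i (Set.mem_image_of_mem _ hx))
      (Set.mem_iUnion_of_mem i (Set.mem_image_of_mem _ hy)) (Pi.single_strictMono i hxy)

end OrderedGroups

/-- An MV-algebra, with `x + y` for the truncated sum and `xᶜ` for the negation. -/
class MVAlgebra (α : Type*) extends AddCommMonoid α, Compl α where
  protected compl_compl : ∀ x : α, xᶜᶜ = x
  protected add_compl_zero : ∀ x : α, x + 0ᶜ = 0ᶜ
  protected lukasiewicz : ∀ x y : α, (xᶜ + y)ᶜ + y = (yᶜ + x)ᶜ + x

namespace MVAlgebra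

variable {α : Type*} [MVAlgebra α] {x y z : α}

attribute [simp] MVAlgebra.compl_compl

theorem compl_injective : Function.Injective (compl : α → α) :=
  Function.LeftInverse.injective MVAlgebra.compl_compl

instance (priority := 100) : One α := ⟨0ᶜ⟩

@[simp] theorem compl_one : (1 : α)ᶜ = 0 := MVAlgebra.compl_compl 0

@[simp] theorem add_one (x : α) : x + 1 = 1 := MVAlgebra.add_compl_zero x

@[simp] theorem one_add (x : α) : 1 + x = 1 := by rw [add_comm, add_one]

@[simp] theorem compl_add_self (x : α) : xᶜ + x = 1 := by
  simpa using (MVAlgebra.lukasiewicz x 1).symm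

instance (priority := 100) : CommMonoid α where
  mul x y := (xᶜ + yᶜ)ᶜ
  mul_assoc x y z := by
    change ((xᶜ + yᶜ)ᶜᶜ + zᶜ)ᶜ = (xᶜ + (yᶜ + zᶜ)ᶜᶜ)ᶜ
    simp only [MVAlgebra.compl_compl, add_assoc]
  mul_comm x y := congrArg compl (add_comm xᶜ yᶜ)
  one_mul x := by
    change ((1 : α)ᶜ + xᶜ)ᶜ = x
    simp
  mul_one x := by
    change (xᶜ + (1 : α)ᶜ)ᶜ = x
    simp

theorem mul_def (x y : α) : x * y = (xᶜ + yᶜ)ᶜ := rfl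

theorem compl_mul (x y : α) : (x * y)ᶜ = xᶜ + yᶜ := by rw [mul_def, MVAlgebra.compl_compl]

theorem compl_add (x y : α) : (x + y)ᶜ = xᶜ * yᶜ := by simp [mul_def]

@[simp] theorem compl_mul_self (x : α) : xᶜ * x = 0 := by
  rw [mul_def, compl_add_self, compl_one]

theorem compl_add_add_of_compl_add_eq_one (h : xᶜ + y = 1) : (yᶜ + x)ᶜ + x = y := by
  rw [← MVAlgebra.lukasiewicz, h, compl_one, zero_add]

instance (priority := 100) : PartialOrder α where
  le x y := xᶜ + y = 1
  le_refl := compl_add_self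
  le_trans x y z (hxy : xᶜ + y = 1) (hyz : yᶜ + z = 1) := by
    rw [← compl_add_add_of_compl_add_eq_one hyz, ← compl_add_add_of_compl_add_eq_one hxy,
      add_left_comm, add_left_comm xᶜ, compl_add_self, add_one, add_one]
  le_antisymm x y (hxy : xᶜ + y = 1) (hyx : yᶜ + x = 1) := by
    rw [← compl_add_add_of_compl_add_eq_one hxy, hyx, compl_one, zero_add]

theorem le_iff_compl_add_eq_one : x ≤ y ↔ xᶜ + y = 1 := Iff.rfl

theorem add_eq_one_iff_compl_le : x + y = 1 ↔ xᶜ ≤ y := by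
  rw [le_iff_compl_add_eq_one, MVAlgebra.compl_compl]

instance (priority := 100) : CanonicallyOrderedAdd α where
  exists_add_of_le {x y} h :=
    ⟨(yᶜ + x)ᶜ, by rw [add_comm, compl_add_add_of_compl_add_eq_one h]⟩
  le_add_self _ _ := by
    rw [le_iff_compl_add_eq_one, add_left_comm, compl_add_self, add_one]
  le_self_add _ _ := by
    rw [le_iff_compl_add_eq_one, ← add_assoc, compl_add_self, one_add]

instance (priority := 100) : IsOrderedAddMonoid α where
  add_le_add_left x y h z := by
    obtain ⟨w, rfl⟩ := exists_add_of_le h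
    rw [add_right_comm]
    exact le_self_add

protected theorem compl_le_compl (h : x ≤ y) : yᶜ ≤ xᶜ := by
  rw [le_iff_compl_add_eq_one, MVAlgebra.compl_compl, add_comm]
  exact h

protected theorem compl_le_compl_iff : xᶜ ≤ yᶜ ↔ y ≤ x :=
  ⟨fun h => by simpa using MVAlgebra.compl_le_compl h, MVAlgebra.compl_le_compl⟩

theorem le_compl_comm : x ≤ yᶜ ↔ y ≤ xᶜ := by
  rw [← MVAlgebra.compl_le_compl_iff, MVAlgebra.compl_compl]

theorem compl_le_comm : xᶜ ≤ y ↔ yᶜ ≤ x := by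
  rw [← MVAlgebra.compl_le_compl_iff, MVAlgebra.compl_compl]

instance (priority := 100) : IsOrderedMonoid α where
  mul_le_mul_left _ _ h z :=
    MVAlgebra.compl_le_compl (add_le_add_left (MVAlgebra.compl_le_compl h) zᶜ)

theorem mul_le_iff_le_compl_add : x * y ≤ z ↔ x ≤ yᶜ + z := by
  rw [le_iff_compl_add_eq_one, le_iff_compl_add_eq_one, compl_mul, add_assoc]

theorem mul_eq_zero_iff_le_compl : x * y = 0 ↔ x ≤ yᶜ := by
  rw [← nonpos_iff_eq_zero, mul_le_iff_le_compl_add, add_zero]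

instance (priority := 100) : BoundedOrder α where
  bot := 0
  bot_le _ := zero_le
  top := 1
  le_top x := add_one xᶜ

theorem le_one (x : α) : x ≤ 1 := le_top (α := α)

theorem one_le_iff_eq_one : 1 ≤ x ↔ x = 1 := top_le_iff (α := α)

theorem mul_le_left (x y : α) : x * y ≤ x := mul_le_of_le_one_right' (le_one y)

theorem mul_le_right (x y : α) : x * y ≤ y := mul_le_of_le_one_left' (le_one x)

instance (priority := 100) : Lattice α where
  sup x y := (xᶜ + y)ᶜ + y
  le_sup_left _ _ := by
    rw [MVAlgebra.lukasiewicz]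
    exact le_add_self
  le_sup_right _ _ := le_add_self
  sup_le x y z hx hy := by
    have h : (xᶜ + y)ᶜ + y ≤ (zᶜ + y)ᶜ + y :=
      add_le_add_left (MVAlgebra.compl_le_compl (add_le_add_left (MVAlgebra.compl_le_compl hx) _)) _
    rwa [compl_add_add_of_compl_add_eq_one hy] at h
  inf x y := ((xᶜᶜ + yᶜ)ᶜ + yᶜ)ᶜ
  inf_le_left _ _ := by
    rw [compl_le_comm, MVAlgebra.lukasiewicz]
    exact le_add_self
  inf_le_right _ _ := by
    rw [compl_le_comm]
    exact le_add_self
  le_inf x y z hy hz := by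
    have h : (yᶜᶜ + zᶜ)ᶜ + zᶜ ≤ (xᶜᶜ + zᶜ)ᶜ + zᶜ := by
      simp only [MVAlgebra.compl_compl]
      exact add_le_add_left (MVAlgebra.compl_le_compl (add_le_add_left hy _)) _
    rwa [compl_add_add_of_compl_add_eq_one (MVAlgebra.compl_le_compl hz), ← le_compl_comm] at h

theorem sup_def (x y : α) : x ⊔ y = (xᶜ + y)ᶜ + y := rfl

protected theorem compl_sup (x y : α) : (x ⊔ y)ᶜ = xᶜ ⊓ yᶜ :=
  (congrArg₂ (fun x y : α => (x ⊔ y)ᶜ) (MVAlgebra.compl_compl x)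
    (MVAlgebra.compl_compl y)).symm

protected theorem compl_inf (x y : α) : (x ⊓ y)ᶜ = xᶜ ⊔ yᶜ := MVAlgebra.compl_compl (xᶜ ⊔ yᶜ)

theorem mul_compl_add (x y : α) : x * (xᶜ + y) = x ⊓ y := by
  rw [← compl_injective.eq_iff, MVAlgebra.compl_inf, compl_mul, sup_comm, sup_def,
    MVAlgebra.compl_compl, add_comm xᶜ, add_comm xᶜ]

theorem compl_mul_add (x y : α) : xᶜ * (x + y) = xᶜ ⊓ y := by
  simpa using mul_compl_add xᶜ y

theorem add_compl_mul (x y : α) : x + xᶜ * y = x ⊔ y := by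
  rw [← compl_injective.eq_iff, MVAlgebra.compl_sup, compl_add, compl_mul, mul_compl_add]

theorem inf_add_mul_compl (x y : α) : x ⊓ y + x * yᶜ = x := by
  calc x ⊓ y + x * yᶜ = x * yᶜ + (x * yᶜ)ᶜ * x := by
        rw [compl_mul, MVAlgebra.compl_compl, mul_comm _ x, mul_compl_add, add_comm]
    _ = x := by rw [add_compl_mul, sup_eq_right.2 (mul_le_left x yᶜ)]

theorem mul_compl_inf_mul_compl (x y : α) : x * yᶜ ⊓ y * xᶜ = 0 := by
  set d := x * yᶜ ⊓ y * xᶜ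
  have hadd : x ⊓ y + d ≤ x ⊓ y := le_inf
    ((add_le_add_right inf_le_left _).trans (inf_add_mul_compl x y).le)
    ((add_le_add_right inf_le_right _).trans (inf_comm x y ▸ inf_add_mul_compl y x).le)
  have hd : d ≤ (x ⊓ y)ᶜ :=
    (inf_le_left.trans (mul_le_right x yᶜ)).trans (MVAlgebra.compl_le_compl inf_le_right)
  refine nonpos_iff_eq_zero.1 ?_
  calc d = (x ⊓ y)ᶜ * (x ⊓ y + d) := by rw [compl_mul_add, inf_eq_right.2 hd]
    _ ≤ (x ⊓ y)ᶜ * (x ⊓ y) := mul_le_mul_right hadd _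
    _ = 0 := compl_mul_self _

theorem compl_add_sup_compl_add (x y : α) : (xᶜ + y) ⊔ (yᶜ + x) = 1 := by
  rw [← compl_injective.eq_iff, MVAlgebra.compl_sup, compl_add, compl_add, MVAlgebra.compl_compl,
    MVAlgebra.compl_compl, mul_compl_inf_mul_compl, compl_one]

theorem mul_compl_add_le (x y : α) : x * (xᶜ + y) ≤ y :=
  (mul_compl_add x y).trans_le inf_le_right

theorem add_mul_le (x y z : α) : (x + y) * z ≤ x + y * z := by
  rw [mul_le_iff_le_compl_add, add_left_comm]
  exact add_le_add_right (mul_le_iff_le_compl_add.1 le_rfl) x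

theorem add_mul_compl_add_mul_le (x x' y y' : α) :
    (x + y) * ((xᶜ + x') * (yᶜ + y')) ≤ x' + y' :=
  calc (x + y) * ((xᶜ + x') * (yᶜ + y'))
      ≤ (x * (xᶜ + x') + y) * (yᶜ + y') := by
        rw [← mul_assoc, add_comm x, add_comm _ y]
        exact mul_le_mul_left (add_mul_le y x _) _
    _ ≤ x * (xᶜ + x') + y * (yᶜ + y') := add_mul_le _ _ _
    _ ≤ x' + y' := add_le_add (mul_compl_add_le x x') (mul_compl_add_le y y')

protected theorem sup_mul (x y z : α) : (x ⊔ y) * z = x * z ⊔ y * z :=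
  GaloisConnection.l_sup (u := fun w : α => zᶜ + w) fun _ _ => mul_le_iff_le_compl_add

protected theorem mul_sup (x y z : α) : x * (y ⊔ z) = x * y ⊔ x * z := by
  simp only [mul_comm x, MVAlgebra.sup_mul]

theorem sup_mul_sup_le (x y z : α) : (x ⊔ z) * (y ⊔ z) ≤ x * y ⊔ z := by
  rw [MVAlgebra.sup_mul, MVAlgebra.mul_sup]
  exact sup_le (sup_le_sup_left (mul_le_right x z) _) ((mul_le_left z _).trans le_sup_right)

theorem add_mul_compl_of_le (h : y ≤ x) : y + x * yᶜ = x := by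
  simpa only [inf_eq_right.2 h] using inf_add_mul_compl x y

theorem add_mul_eq_mul_add (hxy : x * y = 0) (hyz : y * z = 0) : (x + y) * z = x * (y + z) := by
  have hx : y + xᶜ * yᶜ = xᶜ :=
    add_mul_compl_of_le (le_compl_comm.1 (mul_eq_zero_iff_le_compl.1 hxy))
  have hz : y + zᶜ * yᶜ = zᶜ := add_mul_compl_of_le (mul_eq_zero_iff_le_compl.1 hyz)
  rw [← compl_injective.eq_iff, compl_mul, compl_mul, compl_add, compl_add]
  calc xᶜ * yᶜ + zᶜ = xᶜ * yᶜ + (y + zᶜ * yᶜ) := by rw [hz]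
    _ = (y + xᶜ * yᶜ) + yᶜ * zᶜ := by rw [mul_comm zᶜ, add_left_comm, add_assoc]
    _ = xᶜ + yᶜ * zᶜ := by rw [hx]

theorem mul_add_eq_mul_add (hxy : x + y = 1) (hyz : y * z = 0) : x * y + z = x * (y + z) := by
  have hx : yᶜ + x * y = x := by
    simpa using add_mul_compl_of_le (add_eq_one_iff_compl_le.1 (add_comm x y ▸ hxy))
  have hz : z + (y + z)ᶜ = yᶜ := by
    rw [compl_add]
    exact add_mul_compl_of_le (le_compl_comm.1 (mul_eq_zero_iff_le_compl.1 hyz))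
  have hle : x * y + z ≤ y + z := add_le_add_left (mul_le_right x y) z
  calc x * y + z = (y + z) * ((y + z)ᶜ + (x * y + z)) := by
        rw [mul_compl_add, inf_eq_right.2 hle]
    _ = x * (y + z) := by rw [mul_comm, add_comm (y + z)ᶜ, add_assoc, hz, add_comm, hx]

theorem mul_add_eq_add_mul (hxy : x + y = 1) (hyz : y + z = 1) : x * y + z = x + y * z := by
  have h := add_mul_eq_mul_add (x := xᶜ) (y := yᶜ) (z := zᶜ)
    (by rw [← compl_add, hxy, compl_one]) (by rw [← compl_add, hyz, compl_one])
  rwa [← compl_injective.eq_iff, compl_add, compl_add, compl_mul, compl_mul]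

theorem mul_ne_one (hx : x ≠ 1) (y : α) : x * y ≠ 1 :=
  fun h => hx (one_le_iff_eq_one.1 (h.symm.trans_le (mul_le_left x y)))

theorem mul_eq_zero_of_add_ne_one [Std.Total (α := α) (· ≤ ·)] (h : x + y ≠ 1) : x * y = 0 := by
  rcases Std.Total.total (r := (· ≤ ·)) xᶜ y with hle | hle
  · exact absurd (add_eq_one_iff_compl_le.2 hle) h
  · rwa [mul_comm, mul_eq_zero_iff_le_compl]

instance (priority := 100) [Nontrivial α] : NeZero (1 : α) where
  out h := by
    obtain ⟨x, y, hxy⟩ := exists_pair_ne α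
    have hzero (z : α) : z = 0 := nonpos_iff_eq_zero.1 ((le_one z).trans_eq h)
    exact hxy ((hzero x).trans (hzero y).symm)

end MVAlgebra

/-- A homomorphism of MV-algebras. -/
structure MVHom (α β : Type*) [MVAlgebra α] [MVAlgebra β] extends α →+ β where
  map_compl' : ∀ x, toFun xᶜ = (toFun x)ᶜ

namespace MVHom

variable {α β : Type*} [MVAlgebra α] [MVAlgebra β]

instance : FunLike (MVHom α β) α β where
  coe f := f.toFun
  coe_injective f g h := by
    cases f
    cases g
    congr
    exact DFunLike.coe_injective h

instance : AddMonoidHomClass (MVHom α β) α β where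
  map_add f := f.map_add'
  map_zero f := f.map_zero'

variable (f : MVHom α β)

theorem map_compl (x : α) : f xᶜ = (f x)ᶜ := f.map_compl' x

instance : MonoidHomClass (MVHom α β) α β where
  map_one f := (f.map_compl 0).trans (congrArg compl (map_zero f))
  map_mul f x y := by simp only [MVAlgebra.mul_def, map_compl, map_add]

theorem map_sup (x y : α) : f (x ⊔ y) = f x ⊔ f y := by
  simp only [MVAlgebra.sup_def, map_compl, map_add]

protected theorem monotone : Monotone f := fun x y h => by
  obtain ⟨z, rfl⟩ := exists_add_of_le h
  exact (map_add f x z).symm ▸ le_self_add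

end MVHom

/-- A filter (deductive system) of an MV-algebra. -/
structure MVFilter (α : Type*) [MVAlgebra α] extends Submonoid α where
  mem_of_le' : ∀ {x y : α}, x ∈ carrier → x ≤ y → y ∈ carrier

namespace MVFilter

open MVAlgebra

variable {α : Type*} [MVAlgebra α]

instance : SetLike (MVFilter α) α where
  coe F := F.carrier
  coe_injective F G h := by
    cases F
    cases G
    congr
    exact SetLike.coe_injective h

instance : SubmonoidClass (MVFilter α) α where
  mul_mem {F} := F.mul_mem'
  one_mem F := F.one_mem'

instance : PartialOrder (MVFilter α) := .ofSetLike (MVFilter α) α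

variable {F : MVFilter α} {x y z : α}

theorem mem_of_le (hx : x ∈ F) (h : x ≤ y) : y ∈ F := F.mem_of_le' hx h

theorem mem_of_compl_add_mem (hx : x ∈ F) (h : xᶜ + y ∈ F) : y ∈ F :=
  mem_of_le (mul_mem hx h) (mul_compl_add_le x y)

/-- The filter generated by a submonoid. -/
def ofSubmonoid (M : Submonoid α) : MVFilter α where
  carrier := upperClosure (M : Set α)
  one_mem' := ⟨1, M.one_mem, le_rfl⟩
  mul_mem' := by
    rintro x y ⟨m, hm, hx⟩ ⟨n, hn, hy⟩
    exact ⟨m * n, M.mul_mem hm hn, mul_le_mul' hx hy⟩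
  mem_of_le' hx h := (upperClosure (M : Set α)).upper h hx

theorem mem_ofSubmonoid {M : Submonoid α} : x ∈ ofSubmonoid M ↔ ∃ m ∈ M, m ≤ x := Iff.rfl

/-- The preimage of a filter under a homomorphism. -/
def comap {β : Type*} [MVAlgebra β] (f : MVHom α β) (F : MVFilter β) : MVFilter α where
  carrier := f ⁻¹' F
  one_mem' := by
    rw [Set.mem_preimage, map_one f]
    exact one_mem F
  mul_mem' {x y} hx hy := by
    rw [Set.mem_preimage, map_mul f]
    exact F.mul_mem' hx hy
  mem_of_le' hx h := F.mem_of_le' hx (f.monotone h)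

/-- The filter of the elements whose join with `a` lies in `F`. -/
def residual (F : MVFilter α) (a : α) : MVFilter α where
  carrier := {z | z ⊔ a ∈ F}
  one_mem' := mem_of_le (one_mem F) le_sup_left
  mul_mem' hx hy := F.mem_of_le' (F.mul_mem' hx hy) (sup_mul_sup_le _ _ a)
  mem_of_le' hx h := F.mem_of_le' hx (sup_le_sup_right h a)

theorem mem_residual {a : α} : z ∈ F.residual a ↔ z ⊔ a ∈ F := Iff.rfl

theorem le_residual (a : α) : F ≤ F.residual a := fun z hz =>
  mem_of_le (y := z ⊔ a) hz le_sup_left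

section Quotient

theorem compl_add_mem_trans (hxy : xᶜ + y ∈ F) (hyz : yᶜ + z ∈ F) : xᶜ + z ∈ F :=
  mem_of_le (mul_mem hxy hyz)
    ((add_mul_le _ _ _).trans (add_le_add_right (mul_compl_add_le y z) _))

theorem compl_add_add_mem {x' y' : α} (hx : xᶜ + x' ∈ F) (hy : yᶜ + y' ∈ F) :
    (x + y)ᶜ + (x' + y') ∈ F := by
  refine mem_of_le (mul_mem hx hy) ?_
  rw [← mul_le_iff_le_compl_add, mul_comm]
  exact add_mul_compl_add_mul_le _ _ _ _

/-- The congruence of a filter. -/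
def con (F : MVFilter α) : AddCon α where
  r x y := xᶜ + y ∈ F ∧ yᶜ + x ∈ F
  iseqv :=
    { refl x := by simpa only [compl_add_self, and_self] using one_mem F
      symm h := h.symm
      trans h h' := ⟨compl_add_mem_trans h.1 h'.1, compl_add_mem_trans h'.2 h.2⟩ }
  add' hx hy := ⟨compl_add_add_mem hx.1 hy.1, compl_add_add_mem hx.2 hy.2⟩

/-- The quotient of an MV-algebra by a filter. -/
protected abbrev Quotient (F : MVFilter α) : Type _ := F.con.Quotient

instance : MVAlgebra F.Quotient where
  compl := Quotient.map compl fun x y h => by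
    change xᶜᶜ + yᶜ ∈ F ∧ yᶜᶜ + xᶜ ∈ F
    simpa only [MVAlgebra.compl_compl, add_comm _ (_)ᶜ] using h.symm
  compl_compl := by
    rintro ⟨x⟩
    exact congrArg _ (MVAlgebra.compl_compl x)
  add_compl_zero := by
    rintro ⟨x⟩
    exact congrArg _ (MVAlgebra.add_compl_zero x)
  lukasiewicz := by
    rintro ⟨x⟩ ⟨y⟩
    exact congrArg _ (MVAlgebra.lukasiewicz x y)

/-- The projection to the quotient. -/
def proj (F : MVFilter α) : MVHom α F.Quotient where
  toAddMonoidHom := F.con.mk'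
  map_compl' _ := rfl

theorem proj_surjective : Function.Surjective F.proj := AddCon.mk'_surjective

theorem proj_eq_proj_iff : F.proj x = F.proj y ↔ xᶜ + y ∈ F ∧ yᶜ + x ∈ F := AddCon.eq F.con

theorem proj_eq_one_iff : F.proj x = 1 ↔ x ∈ F := by
  rw [← map_one F.proj, proj_eq_proj_iff]
  simp [one_mem F]

theorem proj_le_proj_iff : F.proj x ≤ F.proj y ↔ xᶜ + y ∈ F := by
  rw [le_iff_compl_add_eq_one, ← MVHom.map_compl, ← map_add, proj_eq_one_iff]

variable {β : Type*} [MVAlgebra β] {f : MVHom α β} {G : MVFilter β}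

/-- The homomorphism of quotients that is induced by a homomorphism. -/
def quotientMap (h : G.comap f = F) : MVHom F.Quotient G.Quotient where
  toAddMonoidHom := F.con.lift ((G.proj : β →+ G.Quotient).comp (f : α →+ β)) fun x y hxy => by
    refine proj_eq_proj_iff.2 ?_
    change (f x)ᶜ + f y ∈ G ∧ (f y)ᶜ + f x ∈ G
    rw [← f.map_compl, ← f.map_compl, ← map_add, ← map_add]
    exact (h ▸ hxy : xᶜ + y ∈ G.comap f ∧ yᶜ + x ∈ G.comap f)
  map_compl' := by
    rintro ⟨x⟩
    exact congrArg G.proj (f.map_compl x)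

theorem quotientMap_proj (h : G.comap f = F) (x : α) :
    quotientMap h (F.proj x) = G.proj (f x) := rfl

theorem quotientMap_injective (h : G.comap f = F) : Function.Injective (quotientMap h) := by
  refine proj_surjective.forall₂.2 fun x y hxy => ?_
  rw [quotientMap_proj, quotientMap_proj, proj_eq_proj_iff, ← f.map_compl, ← f.map_compl,
    ← map_add, ← map_add] at hxy
  exact proj_eq_proj_iff.2 (h ▸ hxy)

end Quotient

/-- Proper prime filters. -/
class IsPrime (F : MVFilter α) : Prop where
  zero_notMem : (0 : α) ∉ F
  mem_or_mem : ∀ {x y : α}, x ⊔ y ∈ F → x ∈ F ∨ y ∈ F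

instance [hF : F.IsPrime] : Nontrivial F.Quotient where
  exists_pair_ne := ⟨0, 1, fun h => hF.zero_notMem (proj_eq_one_iff.1 ((map_zero F.proj).trans h))⟩

instance [hF : F.IsPrime] : Std.Total (α := F.Quotient) (· ≤ ·) where
  total := by
    refine proj_surjective.forall₂.2 fun x y => ?_
    rw [proj_le_proj_iff, proj_le_proj_iff]
    exact hF.mem_or_mem (compl_add_sup_compl_add x y ▸ one_mem F)

theorem isPrime_of_maximal_disjoint {D : Set α} (hD : D.Nonempty) (hsup : SupClosed D)
    {P : MVFilter α} (hP : Maximal (fun F : MVFilter α => Disjoint (F : Set α) D) P) :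
    P.IsPrime := by
  have hmax : ∀ {a b : α}, a ⊔ b ∈ P → b ∉ P → ∃ c ∈ D, c ⊔ a ∈ P := by
    intro a b hab hb
    by_contra! hc
    refine hb (hP.2 (y := P.residual a) ?_ (le_residual a) ?_)
    · exact Set.disjoint_right.2 fun c hcD => hc c hcD
    · rwa [mem_residual, sup_comm]
  refine ⟨fun h0 => ?_, fun {a b} hab => ?_⟩
  · obtain ⟨d, hd⟩ := hD
    exact Set.disjoint_left.1 hP.1 (mem_of_le h0 zero_le) hd
  · by_contra! hnot
    obtain ⟨c, hcD, hca⟩ := hmax hab hnot.2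
    obtain ⟨c', hcD', hcc⟩ := hmax hca hnot.1
    exact Set.disjoint_left.1 hP.1 hcc (hsup hcD' hcD)

theorem exists_maximal_disjoint {D : Set α} (hF : Disjoint (F : Set α) D) :
    ∃ P, F ≤ P ∧ Maximal (fun F : MVFilter α => Disjoint (F : Set α) D) P := by
  refine zorn_le_nonempty₀ {P : MVFilter α | Disjoint (P : Set α) D}
    (fun c hc hchain G hG => ?_) F hF
  let U : MVFilter α :=
    { carrier := ⋃ P ∈ c, P
      one_mem' := Set.mem_biUnion hG (one_mem G)
      mul_mem' := fun {x y} hx hy => by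
        obtain ⟨P, hPc, hxP⟩ := Set.mem_iUnion₂.1 hx
        obtain ⟨Q, hQc, hyQ⟩ := Set.mem_iUnion₂.1 hy
        obtain ⟨R, hRc, hPR, hQR⟩ := hchain.directedOn P hPc Q hQc
        exact Set.mem_biUnion hRc (R.mul_mem' (hPR hxP) (hQR hyQ))
      mem_of_le' := fun hx hxy => by
        obtain ⟨P, hPc, hxP⟩ := Set.mem_iUnion₂.1 hx
        exact Set.mem_biUnion hPc (mem_of_le hxP hxy) }
  exact ⟨U, Set.disjoint_iUnion₂_left.2 hc, fun P hP => Set.subset_biUnion_of_mem hP⟩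

section Comap

variable {β : Type*} [MVAlgebra β] {f : MVHom α β} {p : MVFilter α}

theorem disjoint_image_compl_iff {F : MVFilter β} :
    Disjoint (F : Set β) (f '' (p : Set α)ᶜ) ↔ F.comap f ≤ p := by
  rw [Set.disjoint_right, Set.forall_mem_image]
  exact forall_congr' fun _ => not_imp_not

theorem exists_maximal_comap_eq {F : MVFilter β} (hF : F.comap f = p) :
    ∃ P, F ≤ P ∧ Maximal (fun F : MVFilter β => F.comap f = p) P := by
  obtain ⟨P, hFP, hP⟩ := exists_maximal_disjoint (disjoint_image_compl_iff.2 hF.le)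
  simp only [disjoint_image_compl_iff] at hP
  have hPp : P.comap f = p := hP.1.antisymm fun x hx => hFP (hF.ge hx)
  exact ⟨P, hFP, hPp, fun G hG => hP.2 hG.le⟩

theorem isPrime_of_maximal_comap_eq (hp : p.IsPrime) {P : MVFilter β}
    (hP : Maximal (fun F : MVFilter β => F.comap f = p) P) : P.IsPrime := by
  refine isPrime_of_maximal_disjoint (D := f '' (p : Set α)ᶜ) ⟨f 0, 0, hp.zero_notMem, rfl⟩ ?_ ?_
  · rintro _ ⟨x, hx, rfl⟩ _ ⟨y, hy, rfl⟩
    exact ⟨x ⊔ y, fun h => (hp.mem_or_mem h).elim hx hy, f.map_sup x y⟩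
  · simp only [disjoint_image_compl_iff]
    exact ⟨hP.1.le, fun G hG hPG => hP.2 (hG.antisymm fun x hx => hPG (hP.1.ge hx)) hPG⟩

end Comap

theorem exists_isPrime_notMem {d : α} (hd : d ≠ 1) : ∃ P : MVFilter α, P.IsPrime ∧ d ∉ P := by
  have hdisj : Disjoint ((ofSubmonoid ⊥ : MVFilter α) : Set α) {d} := by
    rw [Set.disjoint_singleton_right]
    rintro ⟨m, rfl, hm⟩
    exact hd (one_le_iff_eq_one.1 hm)
  obtain ⟨P, -, hP⟩ := exists_maximal_disjoint hdisj
  exact ⟨P, isPrime_of_maximal_disjoint (Set.singleton_nonempty d) supClosed_singleton hP,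
    Set.disjoint_singleton_right.1 hP.1⟩

theorem IsPrime.finset_sup_notMem (hF : F.IsPrime) {ι : Type*} {s : Finset ι} {x : ι → α}
    (hx : ∀ i ∈ s, x i ∉ F) : s.sup x ∉ F :=
  Finset.sup_induction (p := (· ∉ F)) hF.zero_notMem
    (fun _ ha _ hb hab => (hF.mem_or_mem hab).elim ha hb) hx

theorem exists_orthogonal {ι : Type*} [Finite ι] {P : ι → MVFilter α} (hP : ∀ i, (P i).IsPrime)
    (h : Pairwise fun i j => ¬ P i ≤ P j) :
    ∃ x : ι → α, (∀ i, x i ∉ P i) ∧ Pairwise fun i j => x i ⊔ x j = 1 := by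
  classical
  have := Fintype.ofFinite ι
  have hsep : ∀ i j, ∃ a : α, i ≠ j → a ∈ P i ∧ a ∉ P j := fun i j => by
    by_cases hij : i = j
    · exact ⟨0, fun hne => absurd hij hne⟩
    · obtain ⟨a, ha⟩ := SetLike.not_le_iff_exists.1 (h hij)
      exact ⟨a, fun _ => ha⟩
  choose a ha using hsep
  let x (i : ι) : α := {j | j ≠ i}.toFinset.sup fun j => (a i j)ᶜ + a j i
  have hle (i j : ι) (hij : i ≠ j) : (a i j)ᶜ + a j i ≤ x i :=
    Finset.le_sup (f := fun j => (a i j)ᶜ + a j i) (Set.mem_toFinset.2 hij.symm)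
  refine ⟨x, fun i => (hP i).finset_sup_notMem fun j hj hmem => ?_, fun i j hij => ?_⟩
  · have hji : j ≠ i := Set.mem_toFinset.1 hj
    exact (ha j i hji).2 (mem_of_compl_add_mem (ha i j hji.symm).1 hmem)
  · refine one_le_iff_eq_one.1 ?_
    rw [← compl_add_sup_compl_add (a i j) (a j i)]
    exact sup_le_sup (hle i j hij) (hle j i hij.symm)

end MVFilter

/-- Chang's group of an MV-chain: the element `⟨n, x⟩` stands for `n + x`. -/
@[ext]
structure ChangGroup (α : Type*) [MVAlgebra α] where
  /-- The integral part. -/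
  int : ℤ
  /-- The fractional part. -/
  frac : α
  frac_ne_one : frac ≠ 1

namespace ChangGroup

open MVAlgebra

variable {α : Type*} [MVAlgebra α]

section Group

open Classical in
noncomputable instance : Add (ChangGroup α) where
  add a b := if h : a.frac + b.frac = 1
    then ⟨a.int + b.int + 1, a.frac * b.frac, mul_ne_one a.frac_ne_one b.frac⟩
    else ⟨a.int + b.int, a.frac + b.frac, h⟩

variable {a b c : ChangGroup α}

theorem add_of_add_eq_one (h : a.frac + b.frac = 1) :
    a + b = ⟨a.int + b.int + 1, a.frac * b.frac, mul_ne_one a.frac_ne_one b.frac⟩ := dif_pos h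

theorem add_of_add_ne_one (h : a.frac + b.frac ≠ 1) :
    a + b = ⟨a.int + b.int, a.frac + b.frac, h⟩ := dif_neg h

protected theorem add_comm (a b : ChangGroup α) : a + b = b + a := by
  by_cases h : a.frac + b.frac = 1
  · rw [add_of_add_eq_one h, add_of_add_eq_one ((add_comm _ _).trans h)]
    exact ChangGroup.ext (by simp only; ring) (mul_comm _ _)
  · rw [add_of_add_ne_one h, add_of_add_ne_one (fun h' => h ((add_comm _ _).trans h'))]
    exact ChangGroup.ext (add_comm _ _) (add_comm _ _)

section Neg

variable [Nontrivial α]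

instance : Zero (ChangGroup α) := ⟨⟨0, 0, zero_ne_one⟩⟩

open Classical in
noncomputable instance : Neg (ChangGroup α) where
  neg a := if h : a.frac = 0 then ⟨-a.int, 0, zero_ne_one⟩
    else ⟨-a.int - 1, a.fracᶜ, fun h' => h (compl_injective h')⟩

@[simp] theorem zero_int : (0 : ChangGroup α).int = 0 := rfl

@[simp] theorem zero_frac : (0 : ChangGroup α).frac = 0 := rfl

theorem neg_of_frac_eq_zero (h : a.frac = 0) : -a = ⟨-a.int, 0, zero_ne_one⟩ := dif_pos h

theorem neg_of_frac_ne_zero (h : a.frac ≠ 0) :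
    -a = ⟨-a.int - 1, a.fracᶜ, fun h' => h (compl_injective h')⟩ := dif_neg h

protected theorem zero_add (a : ChangGroup α) : 0 + a = a := by
  rw [add_of_add_ne_one (by simpa using a.frac_ne_one)]
  ext <;> simp

protected theorem neg_add_cancel (a : ChangGroup α) : -a + a = 0 := by
  by_cases h : a.frac = 0
  · rw [neg_of_frac_eq_zero h, add_of_add_ne_one (by simpa using a.frac_ne_one)]
    ext <;> simp [h]
  · rw [neg_of_frac_ne_zero h, add_of_add_eq_one (by simp)]
    exact ChangGroup.ext (by simp only [zero_int]; ring) (compl_mul_self _)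

end Neg

theorem add_assoc_of_add_eq_one_of_add_eq_one (hab : a.frac + b.frac = 1)
    (hbc : b.frac + c.frac = 1) : a + b + c = a + (b + c) := by
  obtain ⟨l, x, hx⟩ := a
  obtain ⟨m, y, hy⟩ := b
  obtain ⟨n, z, hz⟩ := c
  rw [add_of_add_eq_one hab, add_of_add_eq_one hbc]
  have hxyz : x * y + z = x + y * z := mul_add_eq_add_mul hab hbc
  by_cases h : x * y + z = 1
  · rw [add_of_add_eq_one h, add_of_add_eq_one (hxyz ▸ h)]
    exact ChangGroup.ext (by simp only; ring) (mul_assoc _ _ _)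
  · rw [add_of_add_ne_one h, add_of_add_ne_one (hxyz ▸ h)]
    exact ChangGroup.ext (by simp only; ring) hxyz

variable [Std.Total (α := α) (· ≤ ·)]

theorem add_assoc_of_add_eq_one_of_add_ne_one (hab : a.frac + b.frac = 1)
    (hbc : b.frac + c.frac ≠ 1) : a + b + c = a + (b + c) := by
  obtain ⟨l, x, hx⟩ := a
  obtain ⟨m, y, hy⟩ := b
  obtain ⟨n, z, hz⟩ := c
  have hxyz : x * y + z = x * (y + z) := mul_add_eq_mul_add hab (mul_eq_zero_of_add_ne_one hbc)
  have hne : x * y + z ≠ 1 := by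
    rw [hxyz, mul_comm]
    exact mul_ne_one hbc x
  have heq : x + (y + z) = 1 := by rw [← add_assoc, hab, one_add]
  rw [add_of_add_eq_one hab, add_of_add_ne_one hbc, add_of_add_ne_one hne, add_of_add_eq_one heq]
  exact ChangGroup.ext (by simp only; ring) hxyz

theorem add_assoc_of_add_ne_one_of_add_ne_one (hab : a.frac + b.frac ≠ 1)
    (hbc : b.frac + c.frac ≠ 1) : a + b + c = a + (b + c) := by
  obtain ⟨l, x, hx⟩ := a
  obtain ⟨m, y, hy⟩ := b
  obtain ⟨n, z, hz⟩ := c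
  rw [add_of_add_ne_one hab, add_of_add_ne_one hbc]
  by_cases h : x + y + z = 1
  · rw [add_of_add_eq_one h, add_of_add_eq_one ((add_assoc x y z).symm.trans h)]
    exact ChangGroup.ext (by simp only; ring) (add_mul_eq_mul_add (mul_eq_zero_of_add_ne_one hab)
      (mul_eq_zero_of_add_ne_one hbc))
  · rw [add_of_add_ne_one h, add_of_add_ne_one (add_assoc x y z ▸ h)]
    exact ChangGroup.ext (add_assoc _ _ _) (add_assoc _ _ _)

protected theorem add_assoc (a b c : ChangGroup α) : a + b + c = a + (b + c) := by
  by_cases hab : a.frac + b.frac = 1 <;> by_cases hbc : b.frac + c.frac = 1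
  · exact add_assoc_of_add_eq_one_of_add_eq_one hab hbc
  · exact add_assoc_of_add_eq_one_of_add_ne_one hab hbc
  · rw [ChangGroup.add_comm a b, ChangGroup.add_comm b c, ChangGroup.add_comm _ c,
      ChangGroup.add_comm a]
    rw [add_comm] at hab hbc
    exact (add_assoc_of_add_eq_one_of_add_ne_one hbc hab).symm
  · exact add_assoc_of_add_ne_one_of_add_ne_one hab hbc

variable [Nontrivial α]

noncomputable instance : AddCommGroup (ChangGroup α) where
  add_assoc := ChangGroup.add_assoc
  zero_add := ChangGroup.zero_add
  add_zero a := (ChangGroup.add_comm a 0).trans (ChangGroup.zero_add a)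
  nsmul := nsmulRec
  zsmul := zsmulRec
  neg_add_cancel := ChangGroup.neg_add_cancel
  add_comm := ChangGroup.add_comm

/-- The positive cone of Chang's group. -/
noncomputable def cone (α : Type*) [MVAlgebra α] [Std.Total (α := α) (· ≤ ·)] [Nontrivial α] :
    AddGroupCone (ChangGroup α) where
  carrier := {a | 0 ≤ a.int}
  zero_mem' := le_refl (0 : ℤ)
  add_mem' {a b} (ha : 0 ≤ a.int) (hb : 0 ≤ b.int) := by
    rw [Set.mem_ofPred_eq]
    by_cases h : a.frac + b.frac = 1
    · rw [add_of_add_eq_one h]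
      exact add_nonneg (add_nonneg ha hb) zero_le_one
    · rw [add_of_add_ne_one h]
      exact add_nonneg ha hb
  eq_zero_of_mem_of_neg_mem' {a} (ha : 0 ≤ a.int) (hna : 0 ≤ (-a).int) := by
    by_cases h : a.frac = 0
    · rw [neg_of_frac_eq_zero h] at hna
      exact ChangGroup.ext (ha.antisymm' (neg_nonneg.1 hna)) h
    · rw [neg_of_frac_ne_zero h] at hna
      simp only at hna
      omega

noncomputable instance : PartialOrder (ChangGroup α) := .mkOfAddGroupCone (cone α)

instance : IsOrderedAddMonoid (ChangGroup α) := .mkOfCone (cone α)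

theorem nonneg_iff : 0 ≤ a ↔ 0 ≤ a.int := by
  change a - 0 ∈ cone α ↔ _
  rw [sub_zero]
  rfl

end Group

section OfChain

variable [Nontrivial α]

variable (α) in
/-- The strong unit of Chang's group. -/
def unit : ChangGroup α := ⟨1, 0, zero_ne_one⟩

open Classical in
/-- The embedding of an MV-chain as the unit interval of its group. -/
noncomputable def ofChain (x : α) : ChangGroup α :=
  if h : x = 1 then unit α else ⟨0, x, h⟩

theorem ofChain_one : ofChain (1 : α) = unit α := dif_pos rfl

theorem ofChain_of_ne_one {x : α} (h : x ≠ 1) : ofChain x = ⟨0, x, h⟩ := dif_neg h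

theorem ofChain_zero : ofChain (0 : α) = 0 := ofChain_of_ne_one zero_ne_one

theorem ofChain_injective : Function.Injective (ofChain : α → ChangGroup α) := by
  intro x y h
  by_cases hx : x = 1 <;> by_cases hy : y = 1
  · rw [hx, hy]
  · rw [hx, ofChain_one, ofChain_of_ne_one hy] at h
    cases congrArg int h
  · rw [hy, ofChain_one, ofChain_of_ne_one hx] at h
    cases congrArg int h
  · rw [ofChain_of_ne_one hx, ofChain_of_ne_one hy] at h
    exact congrArg frac h

variable [Std.Total (α := α) (· ≤ ·)]

theorem ofChain_nonneg (x : α) : 0 ≤ ofChain x := by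
  rw [nonneg_iff]
  by_cases h : x = 1
  · rw [h, ofChain_one]
    exact zero_le_one (α := ℤ)
  · rw [ofChain_of_ne_one h]

theorem ofChain_add_ofChain (x y : α) :
    ofChain x + ofChain y = ofChain (x + y) + ofChain (x * y) := by
  by_cases hx : x = 1
  · rw [hx, one_add, one_mul]
  by_cases hy : y = 1
  · rw [hy, add_one, mul_one, add_comm]
  rw [ofChain_of_ne_one hx, ofChain_of_ne_one hy]
  by_cases h : x + y = 1
  · rw [add_of_add_eq_one h, h, ofChain_one, ofChain_of_ne_one (mul_ne_one hx y), unit,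
      add_of_add_ne_one (by simpa using mul_ne_one hx y)]
    ext <;> simp
  · rw [add_of_add_ne_one h, mul_eq_zero_of_add_ne_one h, ofChain_zero, add_zero,
      ofChain_of_ne_one h]
    ext <;> simp

theorem ofChain_add_of_add_ne_one {x y : α} (h : x + y ≠ 1) :
    ofChain (x + y) = ofChain x + ofChain y := by
  rw [ofChain_add_ofChain, mul_eq_zero_of_add_ne_one h, ofChain_zero, add_zero]

theorem unit_le_ofChain_add_ofChain {x y : α} (h : x + y = 1) :
    unit α ≤ ofChain x + ofChain y := by
  rw [ofChain_add_ofChain, h, ofChain_one]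
  exact le_add_of_nonneg_right (ofChain_nonneg _)

theorem ofChain_compl (x : α) : ofChain xᶜ = unit α - ofChain x := by
  rw [eq_sub_iff_add_eq, ofChain_add_ofChain, compl_add_self, compl_mul_self, ofChain_one,
    ofChain_zero, add_zero]

theorem ofChain_strictMono : StrictMono (ofChain : α → ChangGroup α) := by
  refine Monotone.strictMono_of_injective (fun x y h => ?_) ofChain_injective
  have := unit_le_ofChain_add_ofChain (le_iff_compl_add_eq_one.1 h)
  rwa [ofChain_compl, sub_add_eq_add_sub, le_sub_iff_add_le, add_le_add_iff_left] at this

end OfChain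

section Map

variable {β : Type*} [MVAlgebra β] [Nontrivial α] [Std.Total (α := α) (· ≤ ·)]
  [Nontrivial β] [Std.Total (α := β) (· ≤ ·)] {f : MVHom α β}

/-- The homomorphism of groups that is induced by an embedding of chains. -/
noncomputable def map (f : MVHom α β) (hf : Function.Injective f) :
    ChangGroup α →+ ChangGroup β :=
  have hone {x : α} (hx : x ≠ 1) : f x ≠ 1 := fun h => hx (hf (h.trans (map_one f).symm))
  .mk' (fun a => ⟨a.int, f a.frac, hone a.frac_ne_one⟩) fun a b => by
    by_cases h : a.frac + b.frac = 1
    · rw [add_of_add_eq_one h, add_of_add_eq_one (by simp only [← map_add, h, map_one])]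
      exact ChangGroup.ext rfl (map_mul f _ _)
    · rw [add_of_add_ne_one h, add_of_add_ne_one (by simpa only [← map_add] using hone h)]
      exact ChangGroup.ext rfl (map_add f _ _)

theorem map_nonneg_iff (hf : Function.Injective f) {a : ChangGroup α} :
    0 ≤ map f hf a ↔ 0 ≤ a := by
  rw [nonneg_iff, nonneg_iff]
  rfl

theorem map_unit (hf : Function.Injective f) : map f hf (unit α) = unit β :=
  ChangGroup.ext rfl (map_zero f)

theorem map_ofChain (hf : Function.Injective f) (x : α) :
    map f hf (ofChain x) = ofChain (f x) := by
  by_cases hx : x = 1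
  · rw [hx, map_one f, ofChain_one, ofChain_one, map_unit]
  · rw [ofChain_of_ne_one hx, ofChain_of_ne_one fun h => hx (hf (h.trans (map_one f).symm))]
    rfl

end Map

end ChangGroup

section JointEmbedding

open MVAlgebra MonadicMV

/-- A map from an MV-algebra to the unit interval that preserves the zero, the negation, and the
sums and the strict inequalities between elements of `T`. -/
structure IsPartialEmbedding {α : Type*} [MVAlgebra α] (T : Set α) (s : α → unitInterval) :
    Prop where
  map_zero : s 0 = 0
  map_compl : ∀ x, s xᶜ = unitInterval.symm (s x)
  map_add : ∀ x ∈ T, ∀ y ∈ T, s (x + y) = truncAdd (s x) (s y)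
  strictMonoOn : StrictMonoOn s T

theorem IsPartialEmbedding.mono {α : Type*} [MVAlgebra α] {S T : Set α} {s : α → unitInterval}
    (hs : IsPartialEmbedding T s) (h : S ⊆ T) : IsPartialEmbedding S s where
  map_zero := hs.map_zero
  map_compl := hs.map_compl
  map_add x hx y hy := hs.map_add x (h hx) y (h hy)
  strictMonoOn := hs.strictMonoOn.mono h

theorem projIcc_add_eq_truncAdd {x y : ℝ} (hx : 0 ≤ x) (hy : 0 ≤ y) :
    Set.projIcc 0 1 zero_le_one (x + y) =
      truncAdd (Set.projIcc 0 1 zero_le_one x) (Set.projIcc 0 1 zero_le_one y) := by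
  refine Subtype.ext ?_
  simp only [truncAdd, Set.coe_projIcc, max_eq_right (le_min zero_le_one (add_nonneg hx hy)),
    max_eq_right (le_min zero_le_one hx), max_eq_right (le_min zero_le_one hy)]
  grind

namespace ChangGroup

variable {α : Type*} [MVAlgebra α] [Nontrivial α] [Std.Total (α := α) (· ≤ ·)]
  {φ : ChangGroup α →+ ℝ} {x y : α}

/-- The map on an MV-chain that is given by a real-valued homomorphism of its group, normalized at
the strong unit and truncated. -/
noncomputable def toUnitInterval (φ : ChangGroup α →+ ℝ) (x : α) : unitInterval :=
  Set.projIcc 0 1 zero_le_one (φ (ofChain x) / φ (unit α))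

theorem toUnitInterval_zero : toUnitInterval φ 0 = 0 := by
  rw [toUnitInterval, ofChain_zero, map_zero, zero_div, Set.projIcc_left]
  rfl

theorem toUnitInterval_compl (hφ : φ (unit α) ≠ 0) (x : α) :
    toUnitInterval φ xᶜ = unitInterval.symm (toUnitInterval φ x) := by
  rw [toUnitInterval, toUnitInterval, unitInterval.symm_projIcc, ofChain_compl, map_sub, sub_div,
    div_self hφ]

theorem toUnitInterval_add (hφ : 0 < φ (unit α)) (hx : 0 ≤ φ (ofChain x))
    (hy : 0 ≤ φ (ofChain y)) (hxy : x + y = 1 → φ (unit α) ≤ φ (ofChain x + ofChain y)) :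
    toUnitInterval φ (x + y) = truncAdd (toUnitInterval φ x) (toUnitInterval φ y) := by
  rw [toUnitInterval, toUnitInterval, toUnitInterval,
    ← projIcc_add_eq_truncAdd (div_nonneg hx hφ.le) (div_nonneg hy hφ.le), ← add_div, ← map_add]
  by_cases h : x + y = 1
  · rw [h, ofChain_one, div_self hφ.ne', Set.projIcc_right,
      Set.projIcc_of_right_le _ ((one_le_div hφ).2 (hxy h))]
  · rw [ofChain_add_of_add_ne_one h]

theorem isPartialEmbedding_toUnitInterval {T : Set α} (h0 : 0 ∈ T) (h1 : 1 ∈ T)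
    (hφ : StrictMonoOn φ (Set.image2 (fun x y => ofChain x + ofChain y) T T)) :
    IsPartialEmbedding T (toUnitInterval φ) := by
  have hmem : ∀ x ∈ T, ofChain x ∈ Set.image2 (fun x y => ofChain x + ofChain y) T T :=
    fun x hx => ⟨0, h0, x, hx, by simp only [ofChain_zero, zero_add]⟩
  have hle : ∀ x ∈ T, ∀ y ∈ T, x ≤ y → φ (ofChain x) ≤ φ (ofChain y) := fun x hx y hy h =>
    hφ.monotoneOn (hmem x hx) (hmem y hy) (ofChain_strictMono.monotone h)
  have hlt : ∀ x ∈ T, ∀ y ∈ T, x < y → φ (ofChain x) < φ (ofChain y) := fun x hx y hy h =>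
    hφ (hmem x hx) (hmem y hy) (ofChain_strictMono h)
  have hnonneg : ∀ x ∈ T, 0 ≤ φ (ofChain x) := fun x hx => by
    simpa only [ofChain_zero, map_zero] using hle 0 h0 x hx zero_le
  have hunit : 0 < φ (unit α) := by
    simpa only [ofChain_zero, map_zero, ofChain_one] using
      hlt 0 h0 1 h1 (bot_lt_iff_ne_bot.2 one_ne_zero)
  have hIcc : ∀ x ∈ T, φ (ofChain x) / φ (unit α) ∈ Set.Icc (0 : ℝ) 1 := fun x hx =>
    ⟨div_nonneg (hnonneg x hx) hunit.le,
      (div_le_one hunit).2 (ofChain_one (α := α) ▸ hle x hx 1 h1 (le_one x))⟩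
  refine ⟨toUnitInterval_zero, toUnitInterval_compl hunit.ne', fun x hx y hy => ?_,
    fun x hx y hy hxy => ?_⟩
  · refine toUnitInterval_add hunit (hnonneg x hx) (hnonneg y hy) fun h => ?_
    exact hφ.monotoneOn (ofChain_one (α := α) ▸ hmem 1 h1) ⟨x, hx, y, hy, rfl⟩
      (unit_le_ofChain_add_ofChain h)
  · exact Set.strictMonoOn_projIcc _ (hIcc x hx) (hIcc y hy)
      (div_lt_div_of_pos_right (hlt x hx y hy hxy) hunit)

end ChangGroup

open ChangGroup in
theorem exists_compatible_isPartialEmbedding {ι β : Type*} {α : ι → Type*} [Finite ι]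
    [MVAlgebra β] [Nontrivial β] [Std.Total (α := β) (· ≤ ·)]
    [∀ i, MVAlgebra (α i)] [∀ i, Nontrivial (α i)] [∀ i, Std.Total (α := α i) (· ≤ ·)]
    {f : ∀ i, MVHom β (α i)} (hf : ∀ i, Function.Injective (f i)) {T : ∀ i, Set (α i)}
    (hT : ∀ i, (T i).Finite) :
    ∃ s : ∀ i, α i → unitInterval, (∀ i j x, s i (f i x) = s j (f j x)) ∧
      ∀ i, IsPartialEmbedding (T i) (s i) := by
  let T' (i : ι) : Set (α i) := insert 0 (insert 1 (T i))
  have hT' (i : ι) : (T' i).Finite := ((hT i).insert 1).insert 0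
  obtain ⟨φ, hcomp, hφ⟩ := exists_compatible_addMonoidHom_strictMonoOn
    (fun i => ChangGroup.map (f i) (hf i)) (fun i _ => (map_nonneg_iff (hf i)).1)
    (fun i => (hT' i).image2 (fun x y => ofChain x + ofChain y) (hT' i))
  refine ⟨fun i => toUnitInterval (φ i), fun i j x => ?_, fun i => ?_⟩
  · dsimp only
    have hij (a : ChangGroup β) : φ i (map (f i) (hf i) a) = φ j (map (f j) (hf j) a) :=
      DFunLike.congr_fun (hcomp i j) a
    rw [toUnitInterval, toUnitInterval, ← map_ofChain (hf i), ← map_ofChain (hf j), hij,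
      ← map_unit (hf i), ← map_unit (hf j), hij]
  · exact (isPartialEmbedding_toUnitInterval (Set.mem_insert _ _)
      (Set.mem_insert_of_mem _ (Set.mem_insert _ _)) (hφ i)).mono
      ((Set.subset_insert _ _).trans (Set.subset_insert _ _))

end JointEmbedding

/-- The width condition on a quantifier `Q`: among `k + 1` pairwise orthogonal elements, the values
of `Q` join to `1`. -/
def HasWidthLE {α : Type*} [MVAlgebra α] (Q : α → α) (k : ℕ) : Prop :=
  ∀ x : Fin (k + 1) → α, (Pairwise fun i j => x i ⊔ x j = 1) →
    (Finset.univ.sup fun i => Q (x i)) = 1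

theorem exists_surjective_of_forall_not_injective {X : Type*} [Nonempty X] {k : ℕ}
    (h : ∀ f : Fin (k + 1) → X, ¬ Function.Injective f) :
    ∃ f : Fin k → X, Function.Surjective f := by
  have hfin : Finite X := by
    by_contra hinf
    have := not_finite_iff_infinite.1 hinf
    exact h _ ((Infinite.natEmbedding X).injective.comp Fin.val_injective)
  have := Fintype.ofFinite X
  have hcard : Fintype.card X ≤ k := by
    by_contra! hlt
    obtain ⟨f⟩ := Function.Embedding.nonempty_of_card_le (α := Fin (k + 1)) (β := X) (by simpa)
    exact h f f.injective
  obtain ⟨f⟩ := Function.Embedding.nonempty_of_card_le (α := X) (β := Fin k) (by simpa)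
  exact ⟨Function.invFun f, Function.invFun_surjective f.injective⟩

/-- A universal quantifier on an MV-algebra. -/
structure IsQuantifier {α : Type*} [MVAlgebra α] (Q : α → α) : Prop where
  apply_le : ∀ x, Q x ≤ x
  apply_compl_add : ∀ x y, Q ((Q x)ᶜ + y) = (Q x)ᶜ + Q y
  apply_sup : ∀ x y, Q (Q x ⊔ y) = Q x ⊔ Q y
  apply_add_self : ∀ x, Q (x + x) = Q x + Q x

namespace IsQuantifier

open MVAlgebra

variable {α : Type*} [MVAlgebra α] {Q : α → α} (hQ : IsQuantifier Q)

section

include hQ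

theorem apply_zero : Q 0 = 0 := nonpos_iff_eq_zero.1 (hQ.apply_le 0)

theorem apply_one : Q 1 = 1 := by
  simpa using hQ.apply_compl_add 1 1

theorem le_apply {x y : α} (h : Q x ≤ y) : Q x ≤ Q y := by
  rw [le_iff_compl_add_eq_one] at h ⊢
  rw [← hQ.apply_compl_add, h, hQ.apply_one]

theorem monotone : Monotone Q := fun _ _ h => hQ.le_apply ((hQ.apply_le _).trans h)

theorem apply_apply (x : α) : Q (Q x) = Q x := (hQ.apply_le _).antisymm (hQ.le_apply le_rfl)

theorem apply_compl {x : α} (hx : Q x = x) : Q xᶜ = xᶜ := by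
  simpa only [hx, hQ.apply_zero, add_zero] using hQ.apply_compl_add x 0

theorem apply_add {x : α} (hx : Q x = x) (y : α) : Q (x + y) = x + Q y := by
  simpa only [hQ.apply_compl hx, MVAlgebra.compl_compl] using hQ.apply_compl_add xᶜ y

theorem apply_mul {x : α} (hx : Q x = x) (y : α) : Q (x * y) = x * Q y := by
  have hadd : xᶜ + Q (x * y) = xᶜ + x * Q y := by
    have hxc := hQ.apply_compl hx
    have hsup (z : α) : xᶜ + x * z = xᶜ ⊔ z := by simpa using add_compl_mul xᶜ z
    rw [← hQ.apply_add hxc, hsup, hsup, ← hxc, hQ.apply_sup]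
  have hcancel {z : α} (hz : z ≤ x) : x * (xᶜ + z) = z := by
    rw [mul_compl_add, inf_eq_right.2 hz]
  rw [← hcancel ((hQ.apply_le _).trans (mul_le_left x y)), hadd, hcancel (mul_le_left x _)]

theorem apply_compl_compl_add_apply (x : α) : Q (xᶜ + Q x)ᶜ = 0 := by
  rw [compl_add, MVAlgebra.compl_compl, mul_comm, hQ.apply_mul (hQ.apply_compl (hQ.apply_apply x)),
    compl_mul_self]

theorem apply_compl_pow {x : α} (hx : Q xᶜ = 0) (n : ℕ) : Q (x ^ n)ᶜ = 0 := by
  have hpow (m : ℕ) : Q (x ^ 2 ^ m)ᶜ = 0 := by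
    induction m with
    | zero => simpa using hx
    | succ m ih => rw [pow_succ, pow_mul, sq, compl_mul, hQ.apply_add_self, ih, add_zero]
  refine nonpos_iff_eq_zero.1 ((hQ.monotone (MVAlgebra.compl_le_compl ?_)).trans_eq (hpow n))
  exact pow_le_pow_right_of_le_one' (le_one x) Nat.lt_two_pow_self.le

end

/-- The subalgebra of the fixed elements of a quantifier. -/
def fixed : AddSubmonoid α where
  carrier := {x | Q x = x}
  zero_mem' := hQ.apply_zero
  add_mem' {x y} (hx : Q x = x) (hy : Q y = y) := (hQ.apply_add hx y).trans (congrArg _ hy)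

instance : MVAlgebra hQ.fixed where
  compl x := ⟨x.1ᶜ, hQ.apply_compl x.2⟩
  compl_compl x := Subtype.ext (MVAlgebra.compl_compl x.1)
  add_compl_zero x := Subtype.ext (MVAlgebra.add_compl_zero x.1)
  lukasiewicz x y := Subtype.ext (MVAlgebra.lukasiewicz x.1 y.1)

/-- The inclusion of the fixed elements. -/
def incl : MVHom hQ.fixed α where
  toAddMonoidHom := hQ.fixed.subtype
  map_compl' _ := rfl

/-- A quantifier, as a map to its fixed elements. -/
def toFixed (x : α) : hQ.fixed := ⟨Q x, hQ.apply_apply x⟩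

theorem apply_incl (x : hQ.fixed) : Q (hQ.incl x) = hQ.incl x := x.2

theorem exists_comap_incl_eq_mem (p : MVFilter hQ.fixed) (a : α) :
    ∃ F : MVFilter α, F.comap hQ.incl = p ∧ aᶜ + Q a ∈ F := by
  let e := aᶜ + Q a
  let F := MVFilter.ofSubmonoid (p.toSubmonoid.map hQ.incl ⊔ Submonoid.powers e)
  have hF {z : α} : z ∈ F ↔ ∃ q ∈ p, ∃ n : ℕ, hQ.incl q * e ^ n ≤ z := by
    rw [MVFilter.mem_ofSubmonoid]
    simp only [Submonoid.mem_sup, Submonoid.mem_map, Submonoid.mem_powers_iff]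
    constructor
    · rintro ⟨_, ⟨_, ⟨q, hq, rfl⟩, _, ⟨n, rfl⟩, rfl⟩, hle⟩
      exact ⟨q, hq, n, hle⟩
    · rintro ⟨q, hq, n, hle⟩
      exact ⟨_, ⟨_, ⟨q, hq, rfl⟩, _, ⟨n, rfl⟩, rfl⟩, hle⟩
  refine ⟨F, le_antisymm (fun c hc => ?_) fun c hc => hF.2 ⟨c, hc, 0, by simp⟩,
    hF.2 ⟨1, one_mem p, 1, by simp [e]⟩⟩
  obtain ⟨q, hq, n, hle⟩ := hF.1 hc
  -- `Q (eⁿ)ᶜ = 0`, so that no power of `e` contributes to the trace of `F` on the fixed elements.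
  have hzero : hQ.incl (qᶜ + c)ᶜ = 0 := nonpos_iff_eq_zero.1 <| calc
    hQ.incl (qᶜ + c)ᶜ = Q (hQ.incl (qᶜ + c)ᶜ) := (hQ.apply_incl _).symm
    _ ≤ Q (e ^ n)ᶜ := by
      refine hQ.monotone ?_
      rwa [hQ.incl.map_compl, MVAlgebra.compl_le_compl_iff, map_add, hQ.incl.map_compl,
        ← mul_le_iff_le_compl_add, mul_comm]
    _ = 0 := hQ.apply_compl_pow (hQ.apply_compl_compl_add_apply a) n
  have hqc : qᶜ + c = 1 :=
    MVAlgebra.compl_injective ((Subtype.ext hzero).trans compl_one.symm)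
  exact MVFilter.mem_of_compl_add_mem hq (hqc ▸ one_mem p)

theorem not_injective_of_maximal_comap_incl_eq {k : ℕ} (hW : HasWidthLE Q k)
    {p : MVFilter hQ.fixed} (hp : p.IsPrime) {P : Fin (k + 1) → MVFilter α}
    (hP : ∀ i, Maximal (fun F : MVFilter α => F.comap hQ.incl = p) (P i)) :
    ¬ Function.Injective P := by
  intro hinj
  have hprime (i : Fin (k + 1)) : (P i).IsPrime := MVFilter.isPrime_of_maximal_comap_eq hp (hP i)
  obtain ⟨x, hxP, hx⟩ := MVFilter.exists_orthogonal hprime fun i j hij hle =>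
    hij (hinj ((hP i).eq_of_le (hP j).1 hle))
  have hmem (i j : Fin (k + 1)) : Q (x i) ∈ P j ↔ hQ.toFixed (x i) ∈ p := by
    rw [← (hP j).1]
    rfl
  refine (hprime 0).finset_sup_notMem (s := Finset.univ) (x := fun i => Q (x i))
    (fun i _ hi => ?_) (hW x hx ▸ one_mem (P 0))
  exact hxP i (MVFilter.mem_of_le ((hmem i i).2 ((hmem i 0).1 hi)) (hQ.apply_le _))

theorem exists_fin_isPrime_comap_incl_eq {k : ℕ} (hW : HasWidthLE Q k) {p : MVFilter hQ.fixed}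
    (hp : p.IsPrime) :
    ∃ P : Fin k → MVFilter α, (∀ i, (P i).IsPrime) ∧ (∀ i, (P i).comap hQ.incl = p) ∧
      ∀ a, ∃ i, aᶜ + Q a ∈ P i := by
  let X := {P : MVFilter α // Maximal (fun F : MVFilter α => F.comap hQ.incl = p) P}
  have hX (a : α) : ∃ P : X, aᶜ + Q a ∈ P.1 := by
    obtain ⟨F, hFp, haF⟩ := hQ.exists_comap_incl_eq_mem p a
    obtain ⟨P, hFP, hP⟩ := MVFilter.exists_maximal_comap_eq hFp
    exact ⟨⟨P, hP⟩, hFP haF⟩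
  have : Nonempty X := (hX 0).nonempty
  obtain ⟨P, hP⟩ := exists_surjective_of_forall_not_injective fun f : Fin (k + 1) → X =>
    fun hf => hQ.not_injective_of_maximal_comap_incl_eq hW hp (fun i => (f i).2)
      (Subtype.val_injective.comp hf)
  exact ⟨fun i => (P i).1, fun i => MVFilter.isPrime_of_maximal_comap_eq hp (P i).2,
    fun i => (P i).2.1, fun a => (hP.exists.1 (hX a))⟩

theorem eq_iInf_of_compatible {ι L : Type*} [CompleteLattice L] {p : MVFilter hQ.fixed}
    {P : ι → MVFilter α} (hP : ∀ i, (P i).comap hQ.incl = p) {s : ∀ i, (P i).Quotient → L}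
    (hs : ∀ i j c, s i (MVFilter.quotientMap (hP i) c) = s j (MVFilter.quotientMap (hP j) c))
    {x : α} (hx : ∃ i, xᶜ + Q x ∈ P i)
    (hle : ∀ i, s i ((P i).proj (Q x)) ≤ s i ((P i).proj x)) (i : ι) :
    s i ((P i).proj (Q x)) = ⨅ j, s j ((P j).proj x) := by
  have hconst (i j : ι) : s i ((P i).proj (Q x)) = s j ((P j).proj (Q x)) :=
    hs i j (p.proj (hQ.toFixed x))
  refine le_antisymm (le_iInf fun j => (hconst i j).trans_le (hle j)) ?_
  obtain ⟨j, hj⟩ := hx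
  have hproj : (P j).proj x = (P j).proj (Q x) :=
    (MVFilter.proj_le_proj_iff.2 hj).antisymm ((P j).proj.monotone (hQ.apply_le x))
  calc ⨅ j, s j ((P j).proj x) ≤ s j ((P j).proj x) := iInf_le _ j
    _ = s j ((P j).proj (Q x)) := by rw [hproj]
    _ = s i ((P i).proj (Q x)) := hconst j i

include hQ in
open MonadicMV in
theorem exists_cube_map_ne {k : ℕ} (hW : HasWidthLE Q k) {T : Set α} (hT : T.Finite) {a b : α}
    (hab : ¬ a ≤ b) :
    ∃ h : α → Cube (Fin k), h 0 = zero ∧ (∀ x, h xᶜ = neg (h x)) ∧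
      (∀ x ∈ T, ∀ y ∈ T, h (x + y) = oplus (h x) (h y)) ∧
      (∀ x ∈ T, h (Q x) = all (h x)) ∧ h a ≠ h b := by
  let d := hQ.toFixed (aᶜ + b)
  have hd : d ≠ 1 := fun hd => hab <| one_le_iff_eq_one.1 <|
    (congrArg Subtype.val hd).symm.le.trans (hQ.apply_le (aᶜ + b))
  obtain ⟨p, hp, hdp⟩ := MVFilter.exists_isPrime_notMem hd
  obtain ⟨P, hPprime, hPp, hatt⟩ := hQ.exists_fin_isPrime_comap_incl_eq hW hp
  let T' := insert a (insert b (T ∪ Q '' T))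
  have hT' : T'.Finite := ((hT.union (hT.image Q)).insert b).insert a
  have hTT' : T ⊆ T' := fun x hx => Or.inr (Or.inr (Or.inl hx))
  obtain ⟨s, hcomp, hs⟩ := exists_compatible_isPartialEmbedding
    (fun i => MVFilter.quotientMap_injective (hPp i)) (fun i => hT'.image (P i).proj)
  have hmem {x} (hx : x ∈ T') (i) : (P i).proj x ∈ (P i).proj '' T' := Set.mem_image_of_mem _ hx
  refine ⟨fun x i => s i ((P i).proj x), ?_, fun x => ?_, fun x hx y hy => ?_, fun x hx => ?_, ?_⟩
  · exact funext fun i => (congrArg (s i) (map_zero (P i).proj)).trans (hs i).map_zero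
  · exact funext fun i => (congrArg (s i) ((P i).proj.map_compl x)).trans ((hs i).map_compl _)
  · exact funext fun i => (congrArg (s i) (map_add (P i).proj x y)).trans
      ((hs i).map_add _ (hmem (hTT' hx) i) _ (hmem (hTT' hy) i))
  · refine funext (hQ.eq_iInf_of_compatible hPp hcomp (hatt x) fun i => ?_)
    exact (hs i).strictMonoOn.monotoneOn (hmem (Or.inr (Or.inr (Or.inr ⟨x, hx, rfl⟩))) i)
      (hmem (hTT' hx) i) ((P i).proj.monotone (hQ.apply_le x))
  · obtain ⟨i, hi⟩ := hatt (aᶜ + b)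
    have hnle : ¬ (P i).proj a ≤ (P i).proj b := fun hle => hdp <| by
      rw [← hPp i]
      exact (MVFilter.mem_of_compl_add_mem (MVFilter.proj_le_proj_iff.1 hle) hi : Q (aᶜ + b) ∈ P i)
    have hlt := lt_of_le_not_ge ((total_of (· ≤ ·) _ _).resolve_left hnle) hnle
    refine fun heq => ((hs i).strictMonoOn (hmem ?_ i) (hmem ?_ i) hlt).ne' (congrFun heq i)
    exacts [Or.inr (Or.inl rfl), Or.inl rfl]

end IsQuantifier

namespace MonadicMV

section PartialHom

open FirstOrder

variable {L : Language} {A B : Type*} [L.Structure A] [L.Structure B]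

/-- A map that preserves the operations on arguments from `T`; the value of the operation may lie
outside of `T`. -/
def IsPartialHom (L : Language) {A B : Type*} [L.Structure A] [L.Structure B] (T : Set A)
    (h : A → B) : Prop :=
  ∀ {n : ℕ} (f : L.Functions n) (x : Fin n → A), (∀ i, x i ∈ T) →
    h (Language.Structure.funMap f x) = Language.Structure.funMap f fun i => h (x i)

theorem IsPartialHom.mono {S T : Set A} {h : A → B} (hh : IsPartialHom L T h) (hST : S ⊆ T) :
    IsPartialHom L S h := fun f x hx => hh f x fun i => hST (hx i)

theorem exists_finite_forall_isPartialHom_realize_comp {X : Type*} (B : Type*) [L.Structure B]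
    (v : X → A) (t : L.Term X) :
    ∃ T : Set A, T.Finite ∧ ∀ h : A → B, IsPartialHom L T h →
      t.realize (h ∘ v) = h (t.realize v) := by
  induction t with
  | var n => exact ⟨∅, Set.finite_empty, fun _ _ => rfl⟩
  | func f ts ih =>
    choose T hT hreal using ih
    refine ⟨(⋃ i, T i) ∪ Set.range fun i => (ts i).realize v,
      (Set.finite_iUnion hT).union (Set.finite_range _), fun h hh => ?_⟩
    rw [Language.Term.realize_func, Language.Term.realize_func,
      hh f _ fun i => Or.inr (Set.mem_range_self i)]
    exact congrArg _ (funext fun i => hreal i h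
      (hh.mono ((Set.subset_iUnion T i).trans Set.subset_union_left)))

theorem QuasiIdentity.Holds.of_exists_isPartialHom {A B : Type*}
    [lang.Structure A] [lang.Structure B] {q : QuasiIdentity}
    (hq : q.Holds B)
    (hAB : ∀ T : Set A, T.Finite → ∀ a b, a ≠ b →
      ∃ h : A → B, IsPartialHom lang T h ∧ h a ≠ h b) :
    q.Holds A := by
  intro v hv
  choose T hT hreal using
    exists_finite_forall_isPartialHom_realize_comp (L := lang) B v
  let E := {e | e ∈ q.conclusion :: q.premises}
  have hE : E.Finite := List.finite_toSet _
  by_contra hne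
  obtain ⟨h, hh, hsep⟩ := hAB (⋃ e ∈ E, T e.1 ∪ T e.2)
    (hE.biUnion fun e _ => (hT e.1).union (hT e.2)) _ _ hne
  have hcomp (e) (he : e ∈ E) :
      e.1.realize (h ∘ v) = h (e.1.realize v) ∧ e.2.realize (h ∘ v) = h (e.2.realize v) := by
    have hsub := Set.subset_biUnion_of_mem (u := fun e => T e.1 ∪ T e.2) he
    exact ⟨hreal _ h (hh.mono (Set.subset_union_left.trans hsub)),
      hreal _ h (hh.mono (Set.subset_union_right.trans hsub))⟩
  have hconcl := hq (h ∘ v) fun e he => by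
    obtain ⟨h₁, h₂⟩ := hcomp e (List.mem_cons_of_mem _ he)
    rw [h₁, h₂, hv e he]
  obtain ⟨h₁, h₂⟩ := hcomp _ List.mem_cons_self
  exact hsep (h₁.symm.trans (hconcl.trans h₂))

end PartialHom

section Cube

open unitInterval

theorem coe_truncAdd (x y : unitInterval) : (truncAdd x y : ℝ) = min 1 ((x : ℝ) + y) := rfl

theorem truncAdd_mono {x x' y y' : unitInterval} (hx : x ≤ x') (hy : y ≤ y') :
    truncAdd x y ≤ truncAdd x' y' :=
  min_le_min_left 1 (add_le_add (α := ℝ) hx hy)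

@[fun_prop]
theorem continuous_truncAdd_comp {Y : Type*} [TopologicalSpace Y] {f g : Y → unitInterval}
    (hf : Continuous f) (hg : Continuous g) : Continuous fun y => truncAdd (f y) (g y) := by
  unfold truncAdd
  fun_prop

theorem truncAdd_symm_truncAdd_symm (x y : unitInterval) :
    truncAdd (σ (truncAdd (σ x) y)) y = max x y := by
  have hx := x.2.2
  refine Subtype.ext ?_
  rw [(Subtype.mono_coe (· ∈ unitInterval)).map_max, coe_truncAdd,
    coe_symm_eq, coe_truncAdd, coe_symm_eq]
  grind

variable {X : Type*}

theorem sup_apply (f g : Cube X) (i : X) : sup f g i = max (f i) (g i) :=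
  truncAdd_symm_truncAdd_symm (f i) (g i)

theorem inf_apply (f g : Cube X) (i : X) : inf f g i = min (f i) (g i) := by
  have : inf f g i = σ (max (σ (f i)) (σ (g i))) := congrArg σ (sup_apply (neg f) (neg g) i)
  rw [this, ← strictAnti_symm.antitone.map_min, symm_symm]

theorem imp_eq_one_of_le {f g : Cube X} (h : ∀ i, f i ≤ g i) : imp f g = one := by
  funext i
  have hle : (f i : ℝ) ≤ g i := h i
  refine Subtype.ext ?_
  change min 1 (1 - (f i : ℝ) + g i) = 1 - 0
  rw [sub_zero, min_eq_left (by linarith)]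

theorem cube_isMV : IsMV (Cube X) where
  add_assoc f g h := by
    funext i
    have hf := (f i).2
    have hg := (g i).2
    have hh := (h i).2
    refine Subtype.ext ?_
    change min 1 ((f i : ℝ) + min 1 ((g i : ℝ) + h i)) = min 1 (min 1 ((f i : ℝ) + g i) + h i)
    grind
  add_comm f g := funext fun i => Subtype.ext <| by
    change min 1 ((f i : ℝ) + g i) = min 1 ((g i : ℝ) + f i)
    rw [add_comm]
  add_zero f := by
    funext i
    refine Subtype.ext ?_
    change min 1 ((f i : ℝ) + 0) = f i
    rw [add_zero, min_eq_right (f i).2.2]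
  neg_neg f := funext fun i => symm_symm (f i)
  add_one f := by
    funext i
    refine Subtype.ext ?_
    change min 1 ((f i : ℝ) + (1 - 0)) = 1 - 0
    rw [sub_zero, min_eq_left (le_add_of_nonneg_left (f i).2.1)]
  lukasiewicz f g := by
    change sup f g = sup g f
    funext i
    rw [sup_apply, sup_apply, max_comm]

-- Apart from `all_imp_self`, the identities with quantifiers say that a monotone or antitone
-- continuous map commutes with suprema or infima.
theorem cube_isMonadicMV : IsMonadicMV (Cube X) where
  toIsMV := cube_isMV
  all_imp_self f := imp_eq_one_of_le fun i => iInf_le f i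
  all_imp_all f g := by
    funext i
    have : Nonempty X := ⟨i⟩
    have hanti : Antitone fun t => truncAdd (σ t) (⨅ j, g j) := fun _ _ h =>
      truncAdd_mono (symm_le_symm.2 h) le_rfl
    exact (hanti.map_ciSup_of_continuousAt (by fun_prop)).symm
  all_all_imp f g := by
    funext i
    have : Nonempty X := ⟨i⟩
    have hmono : Monotone fun t => truncAdd (σ (⨅ j, f j)) t := fun _ _ h =>
      truncAdd_mono le_rfl h
    exact (hmono.map_ciInf_of_continuousAt (by fun_prop)).symm
  all_ex_sup f g := by
    funext i
    have hsup : all (sup (ex f) g) i = ⨅ l, max (⨆ j, f j) (g l) :=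
      iInf_congr fun l => sup_apply (ex f) g l
    rw [hsup, sup_apply]
    exact (sup_iInf_eq _ _).symm
  ex_conj_self f := by
    funext i
    have : Nonempty X := ⟨i⟩
    have hmono : Monotone fun t => σ (truncAdd (σ t) (σ t)) := fun _ _ h =>
      symm_le_symm.2 (truncAdd_mono (symm_le_symm.2 h) (symm_le_symm.2 h))
    exact (hmono.map_ciSup_of_continuousAt (by fun_prop)).symm

theorem bigInf_apply_le {l : List (Cube X)} {f : Cube X} (hf : f ∈ l) (i : X) :
    bigInf l i ≤ f i := by
  induction l with
  | nil => cases hf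
  | cons a l ih =>
    change inf a (bigInf l) i ≤ f i
    rw [inf_apply]
    rcases List.mem_cons.1 hf with rfl | hf
    · exact min_le_left _ _
    · exact (min_le_right _ _).trans (ih hf)

theorem le_bigSup_apply {l : List (Cube X)} {f : Cube X} (hf : f ∈ l) (i : X) :
    f i ≤ bigSup l i := by
  induction l with
  | nil => cases hf
  | cons a l ih =>
    change f i ≤ sup a (bigSup l) i
    rw [sup_apply]
    rcases List.mem_cons.1 hf with rfl | hf
    · exact le_max_left _ _
    · exact (ih hf).trans (le_max_right _ _)

theorem cube_satisfiesW [Finite X] {k : ℕ} (hX : Nat.card X ≤ k) : SatisfiesW k (Cube X) := by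
  intro x
  refine imp_eq_one_of_le fun i => ?_
  have : Nonempty X := ⟨i⟩
  -- Two of the `k + 1` functions attain their minima at the same point.
  choose j hj using fun m => Finite.exists_min (x m)
  obtain ⟨m, n, hne, hmn⟩ : ∃ m n, m ≠ n ∧ j m = j n := by
    have := Fintype.ofFinite X
    rw [Nat.card_eq_fintype_card] at hX
    exact Fintype.exists_ne_map_eq_of_card_lt j (by simpa using Nat.lt_succ_of_le hX)
  wlog hlt : m < n generalizing m n
  · exact this n m hne.symm hmn.symm (lt_of_le_of_ne (not_lt.1 hlt) hne.symm)
  have hjoin (m) :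
      all (x m) i ≤ bigSup ((List.finRange (k + 1)).map fun i => all (x i)) i :=
    le_bigSup_apply (List.mem_map_of_mem (f := fun i => all (x i)) (List.mem_finRange m)) i
  have hall (m) : x m (j m) ≤ all (x m) i := le_iInf (hj m)
  calc _ ≤ all (sup (x m) (x n)) i := bigInf_apply_le (List.mem_map.2 ⟨(m, n), by
        simpa [ltPairs] using hlt, rfl⟩) i
    _ ≤ sup (x m) (x n) (j m) := iInf_le _ _
    _ = max (x m (j m)) (x n (j n)) := by rw [sup_apply, hmn]
    _ ≤ max (all (x m) i) (all (x n) i) := max_le_max (hall m) (hall n)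
    _ ≤ _ := max_le (hjoin m) (hjoin n)

end Cube

section Identities

open FirstOrder

/-- The term algebra, in which the abbreviations of the language denote terms. -/
instance : lang.Structure (lang.Term ℕ) where
  funMap f ts := .func f ts
  RelMap r := nomatch r

variable {A : Type*} [lang.Structure A] (v : ℕ → A) (s t : lang.Term ℕ)

theorem realize_oplus : (oplus s t).realize v = oplus (s.realize v) (t.realize v) :=
  congrArg (Language.Structure.funMap (L := lang) Func.add) (funext fun i => by fin_cases i <;> rfl)

theorem realize_neg : (neg s).realize v = neg (s.realize v) :=
  congrArg (Language.Structure.funMap (L := lang) Func.neg) (funext fun i => by fin_cases i; rfl)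

theorem realize_zero : (zero : lang.Term ℕ).realize v = zero :=
  congrArg (Language.Structure.funMap (L := lang) Func.zero) (Subsingleton.elim _ _)

theorem realize_ex : (ex s).realize v = ex (s.realize v) :=
  congrArg (Language.Structure.funMap (L := lang) Func.ex) (funext fun i => by fin_cases i; rfl)

theorem realize_all : (all s).realize v = all (s.realize v) :=
  congrArg (Language.Structure.funMap (L := lang) Func.all) (funext fun i => by fin_cases i; rfl)

theorem realize_one : (one : lang.Term ℕ).realize v = one := by
  rw [one, realize_neg, realize_zero, one]

theorem realize_imp : (imp s t).realize v = imp (s.realize v) (t.realize v) := by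
  rw [imp, realize_oplus, realize_neg, imp]

theorem realize_conj : (conj s t).realize v = conj (s.realize v) (t.realize v) := by
  simp only [conj, realize_neg, realize_oplus]

theorem realize_sup : (sup s t).realize v = sup (s.realize v) (t.realize v) := by
  simp only [sup, realize_imp]

theorem realize_inf : (inf s t).realize v = inf (s.realize v) (t.realize v) := by
  simp only [inf, realize_neg, realize_sup]

theorem realize_bigInf (l : List (lang.Term ℕ)) :
    (bigInf l).realize v = bigInf (l.map fun t => t.realize v) := by
  induction l with
  | nil => exact realize_one v
  | cons a l ih => exact (realize_inf v a (bigInf l)).trans (congrArg _ ih)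

theorem realize_bigSup (l : List (lang.Term ℕ)) :
    (bigSup l).realize v = bigSup (l.map fun t => t.realize v) := by
  induction l with
  | nil => exact realize_zero v
  | cons a l ih => exact (realize_sup v a (bigSup l)).trans (congrArg _ ih)

/-- An identity `s ≈ t`, as a quasi-identity without premises. -/
def identity (s t : lang.Term ℕ) : QuasiIdentity := ⟨[], s, t⟩

variable {s t} in
theorem identity_holds_iff :
    (identity s t).Holds A ↔ ∀ v : ℕ → A, s.realize v = t.realize v := by
  simp only [QuasiIdentity.Holds, identity, List.not_mem_nil, IsEmpty.forall_iff, implies_true,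
    forall_const]

/-- The defining identities of `MMV_k`. -/
def identities (k : ℕ) : Set QuasiIdentity :=
  let x (n : ℕ) : lang.Term ℕ := .var n
  {identity (oplus (x 0) (oplus (x 1) (x 2))) (oplus (oplus (x 0) (x 1)) (x 2)),
    identity (oplus (x 0) (x 1)) (oplus (x 1) (x 0)),
    identity (oplus (x 0) zero) (x 0),
    identity (neg (neg (x 0))) (x 0),
    identity (oplus (x 0) (neg zero)) (neg zero),
    identity (oplus (neg (oplus (neg (x 0)) (x 1))) (x 1))
      (oplus (neg (oplus (neg (x 1)) (x 0))) (x 0)),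
    identity (imp (all (x 0)) (x 0)) one,
    identity (all (imp (x 0) (all (x 1)))) (imp (ex (x 0)) (all (x 1))),
    identity (all (imp (all (x 0)) (x 1))) (imp (all (x 0)) (all (x 1))),
    identity (all (sup (ex (x 0)) (x 1))) (sup (ex (x 0)) (all (x 1))),
    identity (ex (conj (x 0) (x 0))) (conj (ex (x 0)) (ex (x 0))),
    identity
      (imp (bigInf ((ltPairs (k + 1)).map fun p => all (sup (x p.1) (x p.2))))
        (bigSup ((List.finRange (k + 1)).map fun i : Fin (k + 1) => all (x i)))) one}

theorem quasivariety_identities (k : ℕ) : quasivariety.{u} (identities k) = MMV k := by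
  ext A
  let val (x y z : A) (n : ℕ) : A := match n with | 0 => x | 1 => y | _ => z
  simp only [quasivariety, identities, MMV, Set.mem_ofPred_eq, Set.mem_insert_iff,
    Set.mem_singleton_iff, forall_eq_or_imp, forall_eq, identity_holds_iff, realize_oplus,
    realize_neg, realize_zero, realize_one, realize_imp, realize_all, realize_ex, realize_sup,
    realize_conj, realize_bigInf, realize_bigSup, List.map_map, Function.comp_def,
    Language.Term.realize_var]
  constructor
  · rintro ⟨addAssoc, addComm, addZero, negNeg, addOne, lukasiewicz, allImpSelf,
      allImpAll, allAllImp, allExSup, exConjSelf, width⟩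
    refine ⟨⟨⟨fun x y z => addAssoc (val x y z), fun x y => addComm (val x y y),
      fun x => addZero (val x x x), fun x => negNeg (val x x x), fun x => addOne (val x x x),
      fun x y => lukasiewicz (val x y y)⟩, fun x => allImpSelf (val x x x),
      fun x y => allImpAll (val x y y), fun x y => allAllImp (val x y y),
      fun x y => allExSup (val x y y), fun x => exConjSelf (val x x x)⟩, fun x => ?_⟩
    have : Nonempty A := ⟨x 0⟩
    obtain ⟨v, rfl⟩ := (Fin.val_injective (n := k + 1)).surjective_comp_right x
    exact width v
  · rintro ⟨h, hW⟩
    exact ⟨fun _ => h.add_assoc _ _ _, fun _ => h.add_comm _ _, fun _ => h.add_zero _,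
      fun _ => h.neg_neg _, fun _ => h.add_one _, fun _ => h.lukasiewicz _ _,
      fun _ => h.all_imp_self _, fun _ => h.all_imp_all _ _, fun _ => h.all_all_imp _ _,
      fun _ => h.all_ex_sup _ _, fun _ => h.ex_conj_self _, fun v => hW fun i => v i⟩

end Identities

section Embedding

open FirstOrder MVAlgebra

variable {A : Type*} [lang.Structure A]

theorem isPartialHom_of_map {B : Type*} [lang.Structure B] {T : Set A} {f : A → B}
    (hzero : f zero = zero) (hneg : ∀ x ∈ T, f (neg x) = neg (f x))
    (hoplus : ∀ x ∈ T, ∀ y ∈ T, f (oplus x y) = oplus (f x) (f y))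
    (hex : ∀ x ∈ T, f (ex x) = ex (f x)) (hall : ∀ x ∈ T, f (all x) = all (f x)) :
    IsPartialHom lang T f := by
  intro n g x hx
  change f (Language.Structure.funMap g x) = Language.Structure.funMap g (f ∘ x)
  cases g with
  | zero =>
    obtain rfl : x = ![] := Subsingleton.elim _ _
    exact hzero.trans
      (congrArg (Language.Structure.funMap (L := lang) Func.zero) (Subsingleton.elim ![] _))
  | add =>
    obtain ⟨a, b, rfl⟩ : ∃ a b, x = ![a, b] := ⟨x 0, x 1, (FinVec.etaExpand_eq x).symm⟩
    exact (hoplus a (hx 0) b (hx 1)).trans (congrArg _ (FinVec.etaExpand_eq (f ∘ ![a, b])))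
  | neg =>
    obtain ⟨a, rfl⟩ : ∃ a, x = ![a] := ⟨x 0, (FinVec.etaExpand_eq x).symm⟩
    exact (hneg a (hx 0)).trans (congrArg _ (FinVec.etaExpand_eq (f ∘ ![a])))
  | ex =>
    obtain ⟨a, rfl⟩ : ∃ a, x = ![a] := ⟨x 0, (FinVec.etaExpand_eq x).symm⟩
    exact (hex a (hx 0)).trans (congrArg _ (FinVec.etaExpand_eq (f ∘ ![a])))
  | all =>
    obtain ⟨a, rfl⟩ : ∃ a, x = ![a] := ⟨x 0, (FinVec.etaExpand_eq x).symm⟩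
    exact (hall a (hx 0)).trans (congrArg _ (FinVec.etaExpand_eq (f ∘ ![a])))

/-- The MV-algebra that underlies a monadic MV-algebra. -/
abbrev IsMV.toMVAlgebra (h : IsMV A) : MVAlgebra A where
  add := oplus
  zero := zero
  compl := neg
  nsmul := @nsmulRec A ⟨zero⟩ ⟨oplus⟩
  add_assoc x y z := (h.add_assoc x y z).symm
  zero_add x := (h.add_comm _ _).trans (h.add_zero x)
  add_zero := h.add_zero
  add_comm := h.add_comm
  compl_compl := h.neg_neg
  add_compl_zero := h.add_one
  lukasiewicz := h.lukasiewicz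

namespace IsMonadicMV

theorem all_zero (h : IsMonadicMV A) : all (zero : A) = zero :=
  letI := h.toMVAlgebra
  nonpos_iff_eq_zero.1 (h.all_imp_self 0)

theorem ex_eq (h : IsMonadicMV A) (x : A) : ex x = neg (all (neg x)) := by
  have himp : all (oplus (neg x) (all zero)) = oplus (neg (ex x)) (all zero) :=
    h.all_imp_all x zero
  rw [h.all_zero, h.add_zero, h.add_zero] at himp
  rw [himp, h.neg_neg]

theorem isQuantifier (h : IsMonadicMV A) :
    letI := h.toMVAlgebra
    IsQuantifier (all : A → A) := by
  let := h.toMVAlgebra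
  have himp (x y : A) : all ((all x)ᶜ + y) = (all x)ᶜ + all y := h.all_all_imp x y
  have hex (x : A) : ex x = (all xᶜ)ᶜ := h.ex_eq x
  have hex_all (x : A) : ex (all x) = all x := by
    have hzero : all (0 : A) = 0 := h.all_zero
    have hcompl : all (all x)ᶜ = (all x)ᶜ := by simpa only [hzero, add_zero] using himp x 0
    rw [hex, hcompl, MVAlgebra.compl_compl]
  refine ⟨h.all_imp_self, himp, fun x y => ?_, fun x => ?_⟩
  · have hsup : all (ex (all x) ⊔ y) = ex (all x) ⊔ all y := h.all_ex_sup (all x) y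
    rwa [hex_all] at hsup
  · have hconj : ex (xᶜ * xᶜ) = ex xᶜ * ex xᶜ := h.ex_conj_self xᶜ
    rw [hex, hex, MVAlgebra.compl_compl, compl_mul, MVAlgebra.compl_compl, ← compl_add] at hconj
    exact MVAlgebra.compl_injective hconj

theorem hasWidthLE (h : IsMonadicMV A) {k : ℕ} (hW : SatisfiesW k A) :
    letI := h.toMVAlgebra
    HasWidthLE (all : A → A) k := by
  let := h.toMVAlgebra
  intro x hx
  have hbigInf (l : List A) (hl : ∀ a ∈ l, a = 1) : bigInf l = 1 := by
    induction l with
    | nil => rfl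
    | cons a l ih =>
      change a ⊓ bigInf l = 1
      rw [ih fun b hb => hl b (List.mem_cons_of_mem _ hb), hl a List.mem_cons_self, inf_idem]
  have hpremise : bigInf ((ltPairs (k + 1)).map fun p => all (sup (x p.1) (x p.2))) = 1 := by
    refine hbigInf _ (List.forall_mem_map.2 fun p hp => ?_)
    have hlt : p.1 < p.2 := by simpa using (List.mem_filter.1 hp).2
    change all (x p.1 ⊔ x p.2) = 1
    rw [hx hlt.ne, h.isQuantifier.apply_one]
  have himp := hW x
  rw [hpremise] at himp
  exact one_le_iff_eq_one.1 himp

theorem exists_isPartialHom_ne (h : IsMonadicMV A) {k : ℕ} (hW : SatisfiesW k A) {T : Set A}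
    (hT : T.Finite) {a b : A} (hab : a ≠ b) :
    ∃ f : A → Cube (Fin k), IsPartialHom lang T f ∧ f a ≠ f b := by
  let := h.toMVAlgebra
  wlog hle : ¬ a ≤ b generalizing a b
  · obtain ⟨f, hf, hne⟩ := this hab.symm fun hba => hab ((not_not.1 hle).antisymm hba)
    exact ⟨f, hf, hne.symm⟩
  obtain ⟨f, hzero, hneg, hoplus, hall, hne⟩ :=
    h.isQuantifier.exists_cube_map_ne (h.hasWidthLE hW) (hT.union (hT.image neg)) hle
  refine ⟨f, isPartialHom_of_map hzero (fun x _ => hneg x)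
    (fun x hx y hy => hoplus x (Or.inl hx) y (Or.inl hy)) (fun x hx => ?_)
    fun x hx => hall x (Or.inl hx), hne⟩
  calc f (ex x) = neg (f (all (neg x))) := by rw [h.ex_eq, ← hneg]; rfl
    _ = neg (all (neg (f x))) := by rw [hall _ (Or.inr ⟨x, hx, rfl⟩), ← hneg]; rfl
    _ = ex (f x) := (cube_isMonadicMV.ex_eq (f x)).symm

end IsMonadicMV

end Embedding

end MonadicMV

theorem mainTheorem9 (k : ℕ) :
    MonadicMV.MMV.{u} k = MonadicMV.generatedQuasivariety.{u, 0} (MonadicMV.stdAlg k) := by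
  refine Set.Subset.antisymm (fun A hA => Set.mem_iInter₂.2 fun S hS q hq => ?_) ?_
  · exact (hS q hq).of_exists_isPartialHom fun T hT a b hab =>
      hA.1.exists_isPartialHom_ne hA.2 hT hab
  · have hstd : MonadicMV.stdAlg k ∈ MonadicMV.MMV k :=
      ⟨MonadicMV.cube_isMonadicMV, MonadicMV.cube_satisfiesW (by simp)⟩
    rw [← MonadicMV.quasivariety_identities] at hstd ⊢
    exact Set.iInter₂_subset (MonadicMV.identities k) hstd
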